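/- Let $\ell,T,\alpha>0$, let $\rho,\mu\in L^\infty(0,\ell)$ and $r,\kappa\in H^2(0,\ell)$ with $0<\rho_0\le\rho\le\rho_1$, $0\le\mu_0\le\mu\le\mu_1$, $0<r_0\le r\le r_1$, $0<\kappa_0\le\kappa\le\kappa_1$ on $(0,\ell)$, and put $\mathcal V=\{v\in H^2(0,\ell): v(0)=v_x(0)=0\}$; $(\cdot,\cdot)$ is the inner product of $L^2(0,\ell)$. **Direct problem.** For $g\in L^2(0,T)$ a weak solution $u=u(\cdot,\cdot;g)$ is a function $u\in L^2(0,T;\mathcal V)$ with $u_t\in L^2(0,T;\mathcal V)$, $u_{tt}\in L^2(0,T;L^2(0,\ell))$, $u(0)=u_t(0)=0$ and, for a.e. $t\in(0,T)$ and all $v\in\mathcal V$, $$(\rho u_{tt}(t),v)+(\mu u_t(t),v)+(r u_{xx}(t),v_{xx})+(\kappa u_{xxt}(t),v_{xx})=g(t)v(\ell).$$ This is the weak form of $\rho u_{tt}+\mu u_t+(ru_{xx})_{xx}+(\kappa u_{xxt})_{xx}=0$ with $u(0,t)=u_x(0,t)=0$, $[ru_{xx}+\kappa u_{xxt}]_{x=\ell}=0$,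 $-[(ru_{xx}+\kappa u_{xxt})_x]_{x=\ell}=g(t)$ and zero initial data. Write $M(t;g)=r(0)u_{xx}(0,t)+\kappa(0)u_{xxt}(0,t)$ for the value at $x=0$ of $ru_{xx}(\cdot,t)+\kappa u_{xxt}(\cdot,t)$. **Functionals.** For $C>0$ and $m\in\{1,3\}$ let $\mathcal G_m=\{g\in H^m(0,T): g^{(j)}(0)=0\ (0\le j<m),\ \|g\|_{H^m(0,T)}\le C\}$ (the constant $C$ may be different for $m=1$ and $m=3$). For $\nu,\omega\in L^2(0,T)$ let $$\mathcal J_{1\alpha}(g)=\tfrac12\|u(\ell,\cdot;g)-\nu\|_{L^2(0,T)}^2+\tfrac\alpha2\|g'\|_{L^2(0,T)}^2\quad(g\in\mathcal G_1),$$ $$\mathcal J_{2\alpha}(g)=\tfrac12\|-M(\cdot;g)-\omega\|_{L^2(0,T)}^2+\tfrac\alpha2\|g'''\|_{L^2(0,T)}^2\quad(g\in\mathcal G_3).$$ **Proposition 5.1.** (1) Let $\bar g$ minimize $\mathcal J_{1\alpha}$ over $\mathcal G_1$, and let $\phi=\phi(\cdot,\cdot;\bar g)$ be a weak solution of $$\rho\phi_{tt}-\mu\phi_t+(r\phi_{xx})_{xx}-(\kappa\phi_{xxt})_{xx}=0,\quad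 \phi(x,T)=\phi_t(x,T)=0,\quad \phi(0,t)=\phi_x(0,t)=0,$$ $$[r\phi_{xx}-\kappa\phi_{xxt}]_{x=\ell}=0,\qquad [(-r\phi_{xx}+\kappa\phi_{xxt})_x]_{x=\ell}=u(\ell,t;\bar g)-\nu(t),$$ that is, $\tau\mapsto\phi(\cdot,T-\tau)$ is a weak solution of the direct problem with $g(\tau)$ replaced by $u(\ell,T-\tau;\bar g)-\nu(T-\tau)$. Then $$\int_0^T(g_\alpha-\bar g)\,\phi(\ell,t;\bar g)\,dt+\alpha\int_0^T\bar g'\,(g_\alpha'-\bar g')\,dt\ge0\qquad\text{for all }g_\alpha\in\mathcal G_1 .$$ (2) Let $\bar g$ minimize $\mathcal J_{2\alpha}$ over $\mathcal G_3$, put $\theta(t)=M(t;\bar g)+\omega(t)$, and let $\varphi=\varphi(\cdot,\cdot;\bar g)$ be a weak solution of $$\rho\varphi_{tt}-\mu\varphi_t+(r\varphi_{xx})_{xx}-(\kappa\varphi_{xxt})_{xx}=0,\quad \varphi(x,T)=\varphi_t(x,T)=0,\quad \varphi(0,t)=0,\ \varphi_x(0,t)=\theta(t),$$ $$[r\varphi_{xx}-\kappa\varphi_{xxt}]_{x=\ell}=0,\qquad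 [(-r\varphi_{xx}+\kappa\varphi_{xxt})_x]_{x=\ell}=0,$$ that is, $\varphi\in L^2(0,T;H^2(0,\ell))$, $\varphi(0,t)=0$ and $\varphi_x(0,t)=\theta(t)$ for a.e. $t$, and $$\int_0^T\big[(\rho\varphi,v_{tt})+(\mu\varphi,v_t)+(r\varphi_{xx},v_{xx})+(\kappa\varphi_{xx},v_{xxt})\big]dt=0$$ for all $v\in C^2([0,T];\mathcal V)$ with $v(0)=v_t(0)=0$. Then $$\int_0^T(g_\alpha-\bar g)\,\varphi(\ell,t;\bar g)\,dt+\alpha\int_0^T\bar g'''\,(g_\alpha'''-\bar g''')\,dt\ge0\qquad\text{for all }g_\alpha\in\mathcal G_3 .$$ -/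

import Mathlib

open MeasureTheory Set Filter Topology

noncomputable section

/-! ### Sobolev functions of one real variable -/

/-- The `j`-th derivative of `f` on the interval `[0, L]` (one-sided at the end points). -/
def derivOn (j : ℕ) (L : ℝ) (f : ℝ → ℝ) : ℝ → ℝ := iteratedDerivWithin j f (Icc 0 L)

/-- `f` (its continuous representative, if `m ≥ 1`) belongs to `H^m(0, L)`: the derivatives of
order `< m` are absolutely continuous on `[0, L]`, the one of order `m` is square integrable. -/
def MemSobolev (m : ℕ) (L : ℝ) (f : ℝ → ℝ) : Prop :=
  (∀ j < m, AbsolutelyContinuousOnInterval (derivOn j L f) 0 L) ∧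
    MemLp (derivOn m L f) 2 (volume.restrict (Ioo 0 L))

/-- The norm of `H^m(0, L)`. -/
def sobolevNorm (m : ℕ) (L : ℝ) (f : ℝ → ℝ) : ℝ :=
  Real.sqrt (∑ j ∈ Finset.range (m + 1), ∫ t in (0 : ℝ)..L, (derivOn j L f t) ^ 2)

/-- The set `𝒢_m` of admissible shear forces: `g ∈ H^m(0, T)`, `g^{(j)}(0) = 0` for `j < m`, and
`‖g‖_{H^m(0, T)} ≤ C`. -/
def admissibleSet (m : ℕ) (T C : ℝ) : Set (ℝ → ℝ) :=
  {g | MemSobolev m T g ∧ (∀ j < m, derivOn j T g 0 = 0) ∧ sobolevNorm m T g ≤ C}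

/-! ### The Hilbert spaces `L²(0, ℓ)` and `H²(0, ℓ)` -/

/-- The Hilbert space `L²(0, ℓ)`. -/
abbrev L2 (ℓ : ℝ) : Type := Lp ℝ 2 (volume.restrict (Ioo (0 : ℝ) ℓ))

/-- `f ∈ H¹(0, ℓ)` with weak derivative `f'`: some representative of `f` is a primitive
of `f'`. -/
def HasWeakDeriv {ℓ : ℝ} (f f' : L2 ℓ) : Prop :=
  ∃ c : ℝ, ∀ᵐ x ∂(volume.restrict (Ioo (0 : ℝ) ℓ)), f x = c + ∫ y in (0 : ℝ)..x, f' y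

/-- Square integrable functions on `(0, ℓ)` are integrable on subintervals of `[0, ℓ]`. -/
theorem L2.intervalIntegrable {ℓ : ℝ} (f : L2 ℓ) {a b : ℝ} (ha : a ∈ Icc 0 ℓ)
    (hb : b ∈ Icc 0 ℓ) : IntervalIntegrable f volume a b := by
  have h1 : IntegrableOn f (Ioo 0 ℓ) volume :=
    (Lp.memLp f).integrable (by norm_num)
  rw [← integrableOn_Icc_iff_integrableOn_Ioo] at h1
  exact (h1.mono_set (uIcc_subset_Icc ha hb)).intervalIntegrable

theorem HasWeakDeriv.add {ℓ : ℝ} {f f' g g' : L2 ℓ} (hf : HasWeakDeriv f f')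
    (hg : HasWeakDeriv g g') : HasWeakDeriv (f + g) (f' + g') := by
  obtain ⟨c, hc⟩ := hf
  obtain ⟨d, hd⟩ := hg
  refine ⟨c + d, ?_⟩
  filter_upwards [hc, hd, Lp.coeFn_add f g, ae_restrict_mem measurableSet_Ioo]
    with x h1 h2 h3 hx
  have h0 : (0 : ℝ) ∈ Icc 0 ℓ := ⟨le_rfl, (hx.1.trans hx.2).le⟩
  have hx' : x ∈ Icc 0 ℓ := Ioo_subset_Icc_self hx
  have h4 : ∫ y in (0 : ℝ)..x, (f' + g' : L2 ℓ) y = ∫ y in (0 : ℝ)..x, (f' y + g' y) := by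
    refine intervalIntegral.integral_congr_ae ?_
    have h5 := (ae_restrict_iff' measurableSet_Ioo).1 (Lp.coeFn_add f' g')
    filter_upwards [h5] with y hy hyx
    rw [uIoc_of_le hx.1.le] at hyx
    exact hy ⟨hyx.1, hyx.2.trans_lt hx.2⟩
  rw [h3, Pi.add_apply, h1, h2, h4, intervalIntegral.integral_add
    (f'.intervalIntegrable h0 hx') (g'.intervalIntegrable h0 hx')]
  ring

theorem HasWeakDeriv.smul {ℓ : ℝ} {f f' : L2 ℓ} (a : ℝ) (hf : HasWeakDeriv f f') :
    HasWeakDeriv (a • f) (a • f') := by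
  obtain ⟨c, hc⟩ := hf
  refine ⟨a * c, ?_⟩
  filter_upwards [hc, Lp.coeFn_smul a f, ae_restrict_mem measurableSet_Ioo] with x h1 h3 hx
  have h4 : ∫ y in (0 : ℝ)..x, (a • f' : L2 ℓ) y = ∫ y in (0 : ℝ)..x, a * f' y := by
    refine intervalIntegral.integral_congr_ae ?_
    have h5 := (ae_restrict_iff' measurableSet_Ioo).1 (Lp.coeFn_smul a f')
    filter_upwards [h5] with y hy hyx
    rw [uIoc_of_le hx.1.le] at hyx
    exact hy ⟨hyx.1, hyx.2.trans_lt hx.2⟩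
  rw [h3, Pi.smul_apply, h1, h4, intervalIntegral.integral_const_mul, smul_eq_mul]
  ring

theorem HasWeakDeriv.zero {ℓ : ℝ} : HasWeakDeriv (0 : L2 ℓ) 0 := by
  have h := Lp.coeFn_zero ℝ 2 (volume.restrict (Ioo (0 : ℝ) ℓ))
  refine ⟨0, ?_⟩
  filter_upwards [h, ae_restrict_mem measurableSet_Ioo] with x h1 hx
  have h4 : ∫ y in (0 : ℝ)..x, (0 : L2 ℓ) y = ∫ y in (0 : ℝ)..x, (0 : ℝ) := by
    refine intervalIntegral.integral_congr_ae ?_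
    filter_upwards [(ae_restrict_iff' measurableSet_Ioo).1 h] with y hy hyx
    rw [uIoc_of_le hx.1.le] at hyx
    exact hy ⟨hyx.1, hyx.2.trans_lt hx.2⟩
  rw [h1, h4]
  simp

/-- The Sobolev space `H²(0, ℓ)`: the triples `(v, v_x, v_xx)` in `L²(0, ℓ)³`, with the norm
`(∫ (v² + v_x² + v_xx²) dx)^{1/2}`. -/
def H2Submodule (ℓ : ℝ) : Submodule ℝ (PiLp 2 (fun _ : Fin 3 => L2 ℓ)) where
  carrier := {p | HasWeakDeriv (p 0) (p 1) ∧ HasWeakDeriv (p 1) (p 2)}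
  add_mem' := fun h k => ⟨h.1.add k.1, h.2.add k.2⟩
  zero_mem' := ⟨HasWeakDeriv.zero, HasWeakDeriv.zero⟩
  smul_mem' := fun a _ h => ⟨h.1.smul a, h.2.smul a⟩

/-- `H²(0, ℓ)` as a normed space. -/
abbrev H2 (ℓ : ℝ) : Type := H2Submodule ℓ

namespace H2

variable {ℓ : ℝ}

/-- The `j`-th derivative `∂_x^j v ∈ L²(0, ℓ)`, `j = 0, 1, 2`, of `v ∈ H²(0, ℓ)`. -/
def dx (j : Fin 3) (v : H2 ℓ) : L2 ℓ := v.1 j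

end H2

/-- The value at `x ∈ [0, ℓ]` of the continuous representative of `f ∈ H¹(0, ℓ)` with weak
derivative `f'`: for almost every `y` it is equal to `f y + ∫_y^x f'`, and this is averaged over
`y ∈ (0, ℓ)`. -/
def contRep {ℓ : ℝ} (f f' : L2 ℓ) (x : ℝ) : ℝ :=
  ⨍ y in Ioo (0 : ℝ) ℓ, (f y + ∫ s in y..x, f' s)

/-- `contRep` is a primitive of the derivative, and it represents the function. -/
theorem contRep_spec {ℓ : ℝ} (hℓ : 0 < ℓ) {f f' : L2 ℓ} (h : HasWeakDeriv f f') :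
    (∀ x ∈ Icc 0 ℓ, contRep f f' x = contRep f f' 0 + ∫ y in (0 : ℝ)..x, f' y) ∧
      ∀ᵐ x ∂(volume.restrict (Ioo (0 : ℝ) ℓ)), f x = contRep f f' x := by
  obtain ⟨c, hc⟩ := h
  have key : ∀ x ∈ Icc 0 ℓ, contRep f f' x = c + ∫ y in (0 : ℝ)..x, f' y := by
    intro x hx
    have h0 : (0 : ℝ) ∈ Icc 0 ℓ := ⟨le_rfl, hℓ.le⟩
    have : contRep f f' x = ⨍ _y in Ioo (0 : ℝ) ℓ, (c + ∫ y in (0 : ℝ)..x, f' y) := by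
      unfold contRep
      refine average_congr ?_
      filter_upwards [hc, ae_restrict_mem measurableSet_Ioo] with y hy hyI
      have hy' : y ∈ Icc 0 ℓ := Ioo_subset_Icc_self hyI
      rw [hy, add_assoc, intervalIntegral.integral_add_adjacent_intervals
        (f'.intervalIntegrable h0 hy') (f'.intervalIntegrable hy' hx)]
    rw [this, setAverage_const (by simp [hℓ]) (by simp)]
  refine ⟨fun x hx => ?_, ?_⟩
  · rw [key x hx, key 0 ⟨le_rfl, hℓ.le⟩]
    simp
  · filter_upwards [hc, ae_restrict_mem measurableSet_Ioo] with x hx hxI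
    rw [hx, key x (Ioo_subset_Icc_self hxI)]

namespace H2

variable {ℓ : ℝ}

/-- The point value `v(x)`, `x ∈ [0, ℓ]`, of `v ∈ H²(0, ℓ)`. -/
def val (v : H2 ℓ) (x : ℝ) : ℝ := contRep (v.dx 0) (v.dx 1) x

/-- The point value `v_x(x)`, `x ∈ [0, ℓ]`, of the derivative of `v ∈ H²(0, ℓ)`. -/
def slope (v : H2 ℓ) (x : ℝ) : ℝ := contRep (v.dx 1) (v.dx 2) x

/-- The space `𝒱₁²(0, ℓ) = {v ∈ H²(0, ℓ) : v(0) = v_x(0) = 0}`. -/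
def V (ℓ : ℝ) : Set (H2 ℓ) := {v | v.val 0 = 0 ∧ v.slope 0 = 0}

end H2

/-! ### The beam -/

/-- A beam: its length and its coefficients (mass density, viscous external damping, flexural
rigidity, Kelvin-Voigt damping). -/
structure Beam where
  ℓ : ℝ
  ρ : ℝ → ℝ
  μ : ℝ → ℝ
  r : ℝ → ℝ
  κ : ℝ → ℝ

/-- A function of time with values in `H²(0, ℓ)`, together with its first two time
derivatives. -/
structure Motion (ℓ : ℝ) where
  u : ℝ → H2 ℓ
  ut : ℝ → H2 ℓ
  utt : ℝ → L2 ℓ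

namespace Motion

/-- The motion run backwards, `τ ↦ u(T - τ)`. -/
def reverse {ℓ : ℝ} (T : ℝ) (s : Motion ℓ) : Motion ℓ where
  u := fun τ => s.u (T - τ)
  ut := fun τ => -s.ut (T - τ)
  utt := fun τ => s.utt (T - τ)

end Motion

namespace Beam

variable (B : Beam)

/-- The basic assumptions on the coefficients: `ρ, μ ∈ L^∞(0, ℓ)`, `r, κ ∈ H²(0, ℓ)`,
`0 < ρ₀ ≤ ρ ≤ ρ₁`, `0 ≤ μ₀ ≤ μ ≤ μ₁`, `0 < r₀ ≤ r ≤ r₁`, `0 < κ₀ ≤ κ ≤ κ₁`. -/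
structure Admissible : Prop where
  length_pos : 0 < B.ℓ
  measurable_ρ : AEStronglyMeasurable B.ρ (volume.restrict (Ioo 0 B.ℓ))
  measurable_μ : AEStronglyMeasurable B.μ (volume.restrict (Ioo 0 B.ℓ))
  sobolev_r : MemSobolev 2 B.ℓ B.r
  sobolev_κ : MemSobolev 2 B.ℓ B.κ
  bound_ρ : ∃ ρ₀ ρ₁ : ℝ, 0 < ρ₀ ∧ ∀ᵐ x ∂(volume.restrict (Ioo 0 B.ℓ)), B.ρ x ∈ Icc ρ₀ ρ₁
  bound_μ : ∃ μ₀ μ₁ : ℝ, 0 ≤ μ₀ ∧ ∀ᵐ x ∂(volume.restrict (Ioo 0 B.ℓ)), B.μ x ∈ Icc μ₀ μ₁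
  bound_r : ∃ r₀ r₁ : ℝ, 0 < r₀ ∧ ∀ x ∈ Ioo 0 B.ℓ, B.r x ∈ Icc r₀ r₁
  bound_κ : ∃ κ₀ κ₁ : ℝ, 0 < κ₀ ∧ ∀ x ∈ Ioo 0 B.ℓ, B.κ x ∈ Icc κ₀ κ₁

/-- The weighted inner product `(w f, h) = ∫_0^ℓ w f h dx`. -/
def pair (w : ℝ → ℝ) (f h : L2 B.ℓ) : ℝ := ∫ x in (0 : ℝ)..B.ℓ, w x * f x * h x

/-- `s = (u, u_t, u_tt)` is a weak solution on `[0, T]` of the direct problem with shear force `g`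
at `x = ℓ` and zero initial data:
`ρ u_tt + μ u_t + (r u_xx)_xx + (κ u_xxt)_xx = 0` in `(0, ℓ) × (0, T)`,
`u(x, 0) = u_t(x, 0) = 0`, `u(0, t) = u_x(0, t) = 0`,
`[r u_xx + κ u_xxt]_{x = ℓ} = 0`, `-[(r u_xx + κ u_xxt)_x]_{x = ℓ} = g(t)`. -/
structure IsWeakSolution (T : ℝ) (g : ℝ → ℝ) (s : Motion B.ℓ) : Prop where
  /-- `u, u_t ∈ L²(0, T; 𝒱₁²(0, ℓ))` and `u_tt ∈ L²(0, T; L²(0, ℓ))`. -/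
  memLp_u : MemLp s.u 2 (volume.restrict (Ioo 0 T))
  memLp_ut : MemLp s.ut 2 (volume.restrict (Ioo 0 T))
  memLp_utt : MemLp s.utt 2 (volume.restrict (Ioo 0 T))
  u_mem : ∀ᵐ t ∂(volume.restrict (Ioo 0 T)), s.u t ∈ H2.V B.ℓ
  ut_mem : ∀ᵐ t ∂(volume.restrict (Ioo 0 T)), s.ut t ∈ H2.V B.ℓ
  /-- `u_t` is the time derivative of `u`, and `u(0) = 0`. -/
  u_eq : ∀ᵐ t ∂(volume.restrict (Ioo 0 T)),
    (s.u t).dx 0 = ∫ τ in (0 : ℝ)..t, (s.ut τ).dx 0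
  /-- `u_tt` is the time derivative of `u_t`, and `u_t(0) = 0`. -/
  ut_eq : ∀ᵐ t ∂(volume.restrict (Ioo 0 T)), (s.ut t).dx 0 = ∫ τ in (0 : ℝ)..t, s.utt τ
  weak_form : ∀ᵐ t ∂(volume.restrict (Ioo 0 T)), ∀ v ∈ H2.V B.ℓ,
    B.pair B.ρ (s.utt t) (v.dx 0) + B.pair B.μ ((s.ut t).dx 0) (v.dx 0)
      + B.pair B.r ((s.u t).dx 2) (v.dx 2) + B.pair B.κ ((s.ut t).dx 2) (v.dx 2)
      = g t * v.val B.ℓ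

/-- The deflection `u(ℓ, t)` at the right end. -/
def tip (s : Motion B.ℓ) (t : ℝ) : ℝ := (s.u t).val B.ℓ

/-- The value at `x = 0` of `r u_xx + κ u_xxt` at the time `t`, as the limit of the averages over
`(0, h)`, `h → 0`. -/
def momentAtZero (s : Motion B.ℓ) (t : ℝ) : ℝ :=
  limUnder (𝓝[>] (0 : ℝ)) fun h : ℝ =>
    h⁻¹ * ∫ x in (0 : ℝ)..h, (B.r x * (s.u t).dx 2 x + B.κ x * (s.ut t).dx 2 x)

/-- The measured output `u(ℓ, ·)` of the first inverse problem. -/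
def outputΦ (s : Motion B.ℓ) : ℝ → ℝ := B.tip s

/-- The measured output `-(r(0) u_xx(0, ·) + κ(0) u_xxt(0, ·))` of the second inverse problem. -/
def outputΨ (s : Motion B.ℓ) : ℝ → ℝ := fun t => -B.momentAtZero s t

/-- The regularized Tikhonov functional
`½ ‖output - data‖²_{L²(0, T)} + (α / 2) ‖g^{(m)}‖²_{L²(0, T)}`. -/
def tikhonov (m : ℕ) (T α : ℝ) (data output g : ℝ → ℝ) : ℝ :=
  (1 / 2) * (∫ t in (0 : ℝ)..T, (output t - data t) ^ 2)
    + (α / 2) * ∫ t in (0 : ℝ)..T, (derivOn m T g t) ^ 2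

/-- `g`, with the solution `s` of the direct problem that belongs to it, minimizes over `𝒢_m` the
regularized Tikhonov functional for the given observation `out` of the solutions. -/
def IsOptimal (m : ℕ) (T C α : ℝ) (data : ℝ → ℝ) (out : Motion B.ℓ → ℝ → ℝ)
    (g : ℝ → ℝ) (s : Motion B.ℓ) : Prop :=
  g ∈ admissibleSet m T C ∧ B.IsWeakSolution T g s ∧
    ∀ g' ∈ admissibleSet m T C, ∀ s', B.IsWeakSolution T g' s' →
      tikhonov m T α data (out s) g ≤ tikhonov m T α data (out s') g'

/-- `p = (φ, φ_t, φ_tt)` is a weak solution of the adjoint problem with Neumann input `ξ`: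
`ρ φ_tt - μ φ_t + (r φ_xx)_xx - (κ φ_xxt)_xx = 0`, `φ(x, T) = φ_t(x, T) = 0`,
`φ(0, t) = φ_x(0, t) = 0`, `[r φ_xx - κ φ_xxt]_{x = ℓ} = 0`,
`[(-r φ_xx + κ φ_xxt)_x]_{x = ℓ} = ξ(t)`.
The change of variable `τ = T - t` turns it into the direct problem with input `ξ(T - τ)`. -/
def IsNeumannAdjoint (T : ℝ) (ξ : ℝ → ℝ) (p : Motion B.ℓ) : Prop :=
  B.IsWeakSolution T (fun τ => ξ (T - τ)) (p.reverse T)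

/-- `φ` is a weak solution of the adjoint problem with Dirichlet input `θ`:
`ρ φ_tt - μ φ_t + (r φ_xx)_xx - (κ φ_xxt)_xx = 0`, `φ(x, T) = φ_t(x, T) = 0`,
`φ(0, t) = 0`, `φ_x(0, t) = θ(t)`, `[r φ_xx - κ φ_xxt]_{x = ℓ} = 0`,
`[(-r φ_xx + κ φ_xxt)_x]_{x = ℓ} = 0`.
The equation, the conditions at `t = T` and those at `x = ℓ` are expressed by integration against
test functions `v ∈ C²([0, T]; 𝒱₁²(0, ℓ))` with `v(0) = v_t(0) = 0`. -/
structure IsDirichletAdjoint (T : ℝ) (θ : ℝ → ℝ) (φ : ℝ → H2 B.ℓ) : Prop where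
  memLp : MemLp φ 2 (volume.restrict (Ioo 0 T))
  boundary : ∀ᵐ t ∂(volume.restrict (Ioo 0 T)), (φ t).val 0 = 0 ∧ (φ t).slope 0 = θ t
  weak_form : ∀ v : ℝ → H2 B.ℓ, ContDiff ℝ 2 v → (∀ t, v t ∈ H2.V B.ℓ) → v 0 = 0 →
    deriv v 0 = 0 →
    ∫ t in (0 : ℝ)..T,
      (B.pair B.ρ ((φ t).dx 0) ((deriv (deriv v) t).dx 0)
        + B.pair B.μ ((φ t).dx 0) ((deriv v t).dx 0)
        + B.pair B.r ((φ t).dx 2) ((v t).dx 2)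
        + B.pair B.κ ((φ t).dx 2) ((deriv v t).dx 2)) = 0

end Beam

end

noncomputable section

set_option linter.unusedSectionVars false

local notation "⟪" x ", " y "⟫" => inner ℝ x y

/-! ### Primitives of square integrable functions on an interval -/

section Primitive

variable {E F : Type*} [NormedAddCommGroup E] [NormedSpace ℝ E] [NormedAddCommGroup F]
  [NormedSpace ℝ F] {T : ℝ}

/-- The Bochner space `L²(0, T; E)`. -/
abbrev BochnerL2 (E : Type*) [NormedAddCommGroup E] (T : ℝ) : Type _ :=
  Lp E 2 (volume.restrict (Ioo (0 : ℝ) T))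

theorem intervalIntegral_eq_setIntegral_Ioo (hT : 0 ≤ T) (f : ℝ → E) :
    ∫ t in (0 : ℝ)..T, f t = ∫ t in Ioo 0 T, f t := by
  rw [intervalIntegral.integral_of_le hT, integral_Ioc_eq_integral_Ioo]

theorem MeasureTheory.Integrable.intervalIntegrable_of_Ioo {f : ℝ → E}
    (hf : Integrable f (volume.restrict (Ioo 0 T))) {a b : ℝ} (ha : a ∈ Icc 0 T)
    (hb : b ∈ Icc 0 T) : IntervalIntegrable f volume a b := by
  have h1 : IntegrableOn f (Ioo 0 T) volume := hf
  rw [← integrableOn_Icc_iff_integrableOn_Ioo] at h1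
  exact (h1.mono_set (uIcc_subset_Icc ha hb)).intervalIntegrable

theorem MeasureTheory.MemLp.integrable_of_Ioo {f : ℝ → E}
    (hf : MemLp f 2 (volume.restrict (Ioo 0 T))) : Integrable f (volume.restrict (Ioo 0 T)) :=
  hf.integrable (by norm_num)

theorem intervalIntegral_congr_of_ae_Ioo {f g : ℝ → E}
    (h : f =ᵐ[volume.restrict (Ioo 0 T)] g) {t : ℝ} (ht : t ∈ Icc 0 T) :
    ∫ s in (0 : ℝ)..t, f s = ∫ s in (0 : ℝ)..t, g s := by
  rw [intervalIntegral_eq_setIntegral_Ioo ht.1, intervalIntegral_eq_setIntegral_Ioo ht.1]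
  exact integral_congr_ae (ae_mono (Measure.restrict_mono (Ioo_subset_Ioo_right ht.2) le_rfl) h)

theorem continuousOn_primitive_of_Ioo {f : ℝ → E}
    (hf : Integrable f (volume.restrict (Ioo 0 T))) :
    ContinuousOn (fun t => ∫ s in (0 : ℝ)..t, f s) (Icc 0 T) := by
  have h1 : IntegrableOn f (Icc 0 T) volume := by
    rw [integrableOn_Icc_iff_integrableOn_Ioo]; exact hf
  intro t ht
  have hT : (0 : ℝ) ≤ T := ht.1.trans ht.2
  have := intervalIntegral.continuousOn_primitive_interval (a := 0) (b := T) (f := f)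
    (μ := volume) (by rwa [uIcc_of_le hT])
  rw [uIcc_of_le hT] at this
  exact this t ht

theorem norm_primitive_le {f : ℝ → E} (hf : Integrable f (volume.restrict (Ioo 0 T))) {t : ℝ}
    (ht : t ∈ Icc 0 T) : ‖∫ s in (0 : ℝ)..t, f s‖ ≤ ∫ s in Ioo 0 T, ‖f s‖ := by
  rw [intervalIntegral_eq_setIntegral_Ioo ht.1]
  refine (norm_integral_le_integral_norm _).trans ?_
  exact setIntegral_mono_set hf.norm (ae_of_all _ fun _ => norm_nonneg _)
    (Ioo_subset_Ioo_right ht.2).eventuallyLE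

theorem integral_norm_le_sqrt_mul_norm (hT : 0 ≤ T) (f : BochnerL2 E T) :
    ∫ s in Ioo 0 T, ‖f s‖ ≤ Real.sqrt T * ‖f‖ := by
  have h := eLpNorm_le_eLpNorm_mul_rpow_measure_univ (p := 1) (q := 2) (by norm_num)
    (Lp.aestronglyMeasurable f)
  have hfin : eLpNorm f 2 (volume.restrict (Ioo 0 T)) ≠ ⊤ := Lp.eLpNorm_ne_top f
  rw [integral_norm_eq_lintegral_enorm (Lp.aestronglyMeasurable f),
    ← eLpNorm_one_eq_lintegral_enorm, Lp.norm_def]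
  refine (ENNReal.toReal_mono ?_ h).trans ?_
  · refine ENNReal.mul_ne_top hfin (ENNReal.rpow_ne_top_of_nonneg (by norm_num) (by simp))
  · rw [ENNReal.toReal_mul, mul_comm, ← ENNReal.toReal_rpow]
    simp only [MeasurableSet.univ, Measure.restrict_apply, univ_inter, Real.volume_Ioo, sub_zero,
      ENNReal.toReal_ofReal hT]
    rw [Real.sqrt_eq_rpow]
    norm_num

theorem memLp_of_continuousOn_Icc {f : ℝ → E} (hf : ContinuousOn f (Icc 0 T)) :
    MemLp f 2 (volume.restrict (Ioo 0 T)) := by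
  obtain ⟨M, hM⟩ := isCompact_Icc.exists_bound_of_continuousOn hf
  refine MemLp.of_bound ?_ M ?_
  · exact (hf.mono Ioo_subset_Icc_self).aestronglyMeasurable measurableSet_Ioo
  · filter_upwards [ae_restrict_mem measurableSet_Ioo] with t ht
    exact hM t (Ioo_subset_Icc_self ht)

theorem memLp_primitive {f : ℝ → E} (hf : Integrable f (volume.restrict (Ioo 0 T))) :
    MemLp (fun t => ∫ s in (0 : ℝ)..t, f s) 2 (volume.restrict (Ioo 0 T)) :=
  memLp_of_continuousOn_Icc (continuousOn_primitive_of_Ioo hf)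

/-- The Volterra operator `f ↦ (t ↦ ∫₀ᵗ f)` on `L²(0, T; E)`. -/
def volterra (E : Type*) [NormedAddCommGroup E] [NormedSpace ℝ E] (T : ℝ) :
    BochnerL2 E T →L[ℝ] BochnerL2 E T :=
  LinearMap.mkContinuous
    { toFun := fun f => (memLp_primitive (Lp.memLp f).integrable_of_Ioo).toLp _
      map_add' := by
        intro f g
        apply Lp.ext
        filter_upwards [MemLp.coeFn_toLp (memLp_primitive (Lp.memLp (f + g)).integrable_of_Ioo),
          MemLp.coeFn_toLp (memLp_primitive (Lp.memLp f).integrable_of_Ioo),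
          MemLp.coeFn_toLp (memLp_primitive (Lp.memLp g).integrable_of_Ioo),
          Lp.coeFn_add (MemLp.toLp _ (memLp_primitive (Lp.memLp f).integrable_of_Ioo))
            (MemLp.toLp _ (memLp_primitive (Lp.memLp g).integrable_of_Ioo)),
          ae_restrict_mem measurableSet_Ioo] with t h1 h2 h3 h4 ht
        have ht' := Ioo_subset_Icc_self ht
        have h0 : (0 : ℝ) ∈ Icc 0 T := ⟨le_rfl, (ht.1.trans ht.2).le⟩
        rw [h1, h4, Pi.add_apply, h2, h3,
          intervalIntegral_congr_of_ae_Ioo (Lp.coeFn_add f g) ht']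
        exact intervalIntegral.integral_add
          ((Lp.memLp f).integrable_of_Ioo.intervalIntegrable_of_Ioo h0 ht')
          ((Lp.memLp g).integrable_of_Ioo.intervalIntegrable_of_Ioo h0 ht')
      map_smul' := by
        intro a f
        apply Lp.ext
        filter_upwards [MemLp.coeFn_toLp (memLp_primitive (Lp.memLp (a • f)).integrable_of_Ioo),
          MemLp.coeFn_toLp (memLp_primitive (Lp.memLp f).integrable_of_Ioo),
          Lp.coeFn_smul a (MemLp.toLp _ (memLp_primitive (Lp.memLp f).integrable_of_Ioo)),
          ae_restrict_mem measurableSet_Ioo] with t h1 h2 h4 ht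
        rw [h1, RingHom.id_apply, h4, Pi.smul_apply, h2,
          intervalIntegral_congr_of_ae_Ioo (Lp.coeFn_smul a f) (Ioo_subset_Icc_self ht)]
        exact intervalIntegral.integral_smul a _ }
    (((volume.restrict (Ioo 0 T)).real univ) ^ ((2 : ENNReal).toReal)⁻¹ * Real.sqrt T) <| by
  intro f
  rw [mul_assoc]
  rcases le_or_gt 0 T with hT | hT
  · refine Lp.norm_le_of_ae_bound (by positivity) ?_
    filter_upwards [MemLp.coeFn_toLp (memLp_primitive (Lp.memLp f).integrable_of_Ioo),
      ae_restrict_mem measurableSet_Ioo] with t h1 ht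
    simp only [LinearMap.coe_mk, AddHom.coe_mk]
    rw [h1]
    exact (norm_primitive_le (Lp.memLp f).integrable_of_Ioo (Ioo_subset_Icc_self ht)).trans
      (integral_norm_le_sqrt_mul_norm hT f)
  · refine Lp.norm_le_of_ae_bound (by positivity) ?_
    filter_upwards [ae_restrict_mem measurableSet_Ioo] with t ht
    exact absurd (ht.1.trans ht.2) (not_lt.2 hT.le)

theorem coeFn_volterra (f : BochnerL2 E T) :
    volterra E T f =ᵐ[volume.restrict (Ioo 0 T)] fun t => ∫ s in (0 : ℝ)..t, f s :=
  MemLp.coeFn_toLp (memLp_primitive (Lp.memLp f).integrable_of_Ioo)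

theorem ContinuousLinearMap.intervalIntegral_comp_of_Ioo [CompleteSpace E] [CompleteSpace F]
    (L : E →L[ℝ] F)
    {f : ℝ → E} (hf : Integrable f (volume.restrict (Ioo 0 T))) {t : ℝ} (ht : t ∈ Icc 0 T) :
    ∫ s in (0 : ℝ)..t, L (f s) = L (∫ s in (0 : ℝ)..t, f s) :=
  L.intervalIntegral_comp_comm
    (hf.intervalIntegrable_of_Ioo ⟨le_rfl, ht.1.trans ht.2⟩ ht)

theorem primitive_injective [CompleteSpace E] {f g : ℝ → E}
    (hf : Integrable f (volume.restrict (Ioo 0 T)))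
    (hg : Integrable g (volume.restrict (Ioo 0 T)))
    (h : (fun t => ∫ s in (0 : ℝ)..t, f s) =ᵐ[volume.restrict (Ioo 0 T)]
      fun t => ∫ s in (0 : ℝ)..t, g s) : f =ᵐ[volume.restrict (Ioo 0 T)] g := by
  rcases le_or_gt T 0 with hT | hT
  · simp [Ioo_eq_empty (not_lt.2 hT), EventuallyEq]
  have h0 : (0 : ℝ) ∈ Icc 0 T := ⟨le_rfl, hT.le⟩
  have hTT : T ∈ Icc 0 T := ⟨hT.le, le_rfl⟩
  have hev : EqOn (fun t => ∫ s in (0 : ℝ)..t, f s) (fun t => ∫ s in (0 : ℝ)..t, g s)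
      (Ioo 0 T) :=
    Measure.eqOn_open_of_ae_eq h isOpen_Ioo
      ((continuousOn_primitive_of_Ioo hf).mono Ioo_subset_Icc_self)
      ((continuousOn_primitive_of_Ioo hg).mono Ioo_subset_Icc_self)
  have h1 := (hf.intervalIntegrable_of_Ioo h0 hTT).ae_hasDerivAt_integral
  have h2 := (hg.intervalIntegrable_of_Ioo h0 hTT).ae_hasDerivAt_integral
  filter_upwards [ae_restrict_of_ae h1, ae_restrict_of_ae h2,
    ae_restrict_mem measurableSet_Ioo] with t ht1 ht2 ht
  have htu : t ∈ uIcc 0 T := by rw [uIcc_of_le hT.le]; exact Ioo_subset_Icc_self ht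
  have h0u : (0 : ℝ) ∈ uIcc 0 T := left_mem_uIcc
  refine (ht1 htu 0 h0u).unique ((ht2 htu 0 h0u).congr_of_eventuallyEq ?_)
  filter_upwards [isOpen_Ioo.mem_nhds ht] with s hs using hev hs

end Primitive

section Fubini

variable {E : Type*} [NormedAddCommGroup E] [InnerProductSpace ℝ E] [CompleteSpace E] {T : ℝ}

/-- The adjoint of `g ↦ ∫₀ᵗ g` is `f ↦ ∫ₜᵀ f`. -/
theorem integral_inner_primitive (hT : 0 ≤ T) {f g : ℝ → E}
    (hf : Integrable f (volume.restrict (Ioo 0 T)))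
    (hg : Integrable g (volume.restrict (Ioo 0 T))) :
    ∫ t in Ioo 0 T, ⟪f t, ∫ s in (0 : ℝ)..t, g s⟫ =
      ∫ t in Ioo 0 T, ⟪∫ s in t..T, f s, g t⟫ := by
  have hT' : T ∈ Icc 0 T := ⟨hT, le_rfl⟩
  have h0 : (0 : ℝ) ∈ Icc 0 T := ⟨le_rfl, hT⟩
  let k : ℝ → ℝ → ℝ := fun t s => (Ioo 0 t).indicator (fun s => ⟪f t, g s⟫) s
  have hL : ∀ t ∈ Ioo 0 T, ⟪f t, ∫ s in (0 : ℝ)..t, g s⟫ = ∫ s in Ioo 0 T, k t s := by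
    intro t ht
    simp only [k]
    rw [integral_indicator measurableSet_Ioo, Measure.restrict_restrict measurableSet_Ioo,
      inter_eq_left.2 (Ioo_subset_Ioo_right ht.2.le), intervalIntegral_eq_setIntegral_Ioo ht.1.le]
    exact (integral_inner (hg.mono_measure
      (Measure.restrict_mono (Ioo_subset_Ioo_right ht.2.le) le_rfl)) (f t)).symm
  have hR : ∀ s ∈ Ioo 0 T, ⟪∫ t in s..T, f t, g s⟫ = ∫ t in Ioo 0 T, k t s := by
    intro s hs
    have hk : ∀ t ∈ Ioo 0 T, k t s = (Ioo s T).indicator (fun t => ⟪g s, f t⟫) t := by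
      intro t ht
      simp only [k, indicator_apply, mem_Ioo, hs.1, true_and, ht.2, and_true]
      rw [real_inner_comm]
    rw [setIntegral_congr_fun measurableSet_Ioo hk, integral_indicator measurableSet_Ioo,
      Measure.restrict_restrict measurableSet_Ioo,
      inter_eq_left.2 (Ioo_subset_Ioo_left hs.1.le), intervalIntegral.integral_of_le hs.2.le,
      integral_Ioc_eq_integral_Ioo, real_inner_comm]
    exact (integral_inner (hf.mono_measure
      (Measure.restrict_mono (Ioo_subset_Ioo_left hs.1.le) le_rfl)) (g s)).symm
  rw [setIntegral_congr_fun measurableSet_Ioo hL, setIntegral_congr_fun measurableSet_Ioo hR]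
  refine integral_integral_swap ?_
  have hprod : Integrable (fun z : ℝ × ℝ => ⟪f z.1, g z.2⟫)
      ((volume.restrict (Ioo 0 T)).prod (volume.restrict (Ioo 0 T))) :=
    hf.op_fst_snd (op := fun x y => ⟪x, y⟫) (by fun_prop)
      ⟨1, fun x y => by simpa using norm_inner_le_norm (𝕜 := ℝ) x y⟩ hg
  have hm : MeasurableSet {z : ℝ × ℝ | z.2 ∈ Ioo 0 z.1} := by
    have : {z : ℝ × ℝ | z.2 ∈ Ioo 0 z.1} = {z | 0 < z.2} ∩ {z | z.2 < z.1} := rfl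
    rw [this]
    exact (measurableSet_lt measurable_const measurable_snd).inter
      (measurableSet_lt measurable_snd measurable_fst)
  exact hprod.indicator hm

end Fubini

/-! ### Ranges of operators between Hilbert spaces -/

section Range

variable {Y Z : Type*} [NormedAddCommGroup Y] [InnerProductSpace ℝ Y] [CompleteSpace Y]
  [NormedAddCommGroup Z] [InnerProductSpace ℝ Z] [CompleteSpace Z]

/-- A vector whose inner products are controlled by the adjoint is in the range of an operator. -/
theorem ContinuousLinearMap.exists_apply_eq_of_inner_le (A : Z →L[ℝ] Y) (b : Y) (C : ℝ)
    {D : Set Y} (hD : Dense D) (h : ∀ y ∈ D, |⟪b, y⟫| ≤ C * ‖A.adjoint y‖) : ∃ z, A z = b := by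
  have hall : ∀ y, |⟪b, y⟫| ≤ C * ‖A.adjoint y‖ := by
    intro y
    have hcl : IsClosed {y : Y | |⟪b, y⟫| ≤ C * ‖A.adjoint y‖} :=
      isClosed_le (by fun_prop) (by fun_prop)
    exact (hcl.closure_subset_iff.2 h) (hD y)
  have hmem : (innerSL ℝ b : Y →L[ℝ] ℝ).toLinearMap ∈
      LinearMap.range (A.adjoint.toLinearMap).dualMap := by
    rw [LinearMap.range_dualMap_eq_dualAnnihilator_ker, Submodule.mem_dualAnnihilator]
    intro y hy
    have hy' : A.adjoint y = 0 := hy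
    have := hall y
    rw [hy', norm_zero, mul_zero] at this
    simpa using this
  obtain ⟨f, hf⟩ := hmem
  have hf' : ∀ y, f (A.adjoint y) = ⟪b, y⟫ := fun y => LinearMap.congr_fun hf y
  let p : Subspace ℝ Z := LinearMap.range A.adjoint.toLinearMap
  let f0 : StrongDual ℝ p := LinearMap.mkContinuous (f.domRestrict p) C <| by
    rintro ⟨_, y, rfl⟩
    change |f (A.adjoint y)| ≤ C * ‖A.adjoint y‖
    rw [hf']
    exact hall y
  obtain ⟨g, hg, -⟩ := exists_extension_norm_eq p f0
  refine ⟨(InnerProductSpace.toDual ℝ Z).symm g, ?_⟩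
  refine ext_inner_right ℝ fun y => ?_
  rw [← ContinuousLinearMap.adjoint_inner_right, InnerProductSpace.toDual_symm_apply, ← hf']
  exact hg ⟨A.adjoint y, y, rfl⟩

end Range

/-! ### Strongly damped second order systems -/

/-- The data of the evolution equation `S† ρ S u'' + S† μ S u' + κ u' + R u = h b`. -/
structure DampedSystem (V H : Type*) [NormedAddCommGroup V] [InnerProductSpace ℝ V]
    [NormedAddCommGroup H] [InnerProductSpace ℝ H] where
  S : V →L[ℝ] H
  ρ : H →L[ℝ] H
  μ : H →L[ℝ] H
  R : V →L[ℝ] V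
  κ : V →L[ℝ] V
  b : V

namespace DampedSystem

variable {V H : Type*} [NormedAddCommGroup V] [InnerProductSpace ℝ V] [CompleteSpace V]
  [NormedAddCommGroup H] [InnerProductSpace ℝ H] [CompleteSpace H] (D : DampedSystem V H)

/-- Coercivity of the mass and of the strong damping. -/
structure Coercive : Prop where
  ρ_pos : ∃ c > 0, ∀ p, c * ‖p‖ ^ 2 ≤ ⟪D.ρ p, p⟫
  κ_pos : ∃ c > 0, ∀ w, c * ‖w‖ ^ 2 ≤ ⟪D.κ w, w⟫
  κ_symm : ∀ v w, ⟪D.κ v, w⟫ = ⟪D.κ w, v⟫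

/-- The velocity `U` and the acceleration `P` solve the system with zero initial data. -/
structure IsSol (T : ℝ) (h : ℝ → ℝ) (U : ℝ → V) (P : ℝ → H) : Prop where
  memLp_U : MemLp U 2 (volume.restrict (Ioo 0 T))
  memLp_P : MemLp P 2 (volume.restrict (Ioo 0 T))
  S_eq : ∀ᵐ t ∂(volume.restrict (Ioo 0 T)), D.S (U t) = ∫ s in (0 : ℝ)..t, P s
  eqn : ∀ᵐ t ∂(volume.restrict (Ioo 0 T)),
    D.S.adjoint (D.ρ (P t)) + D.S.adjoint (D.μ (D.S (U t))) + D.R (∫ s in (0 : ℝ)..t, U s)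
      + D.κ (U t) = h t • D.b

/-- The weights in the energy estimate. -/
theorem exists_weights (hD : D.Coercive) : ∃ A l c : ℝ, 0 < c ∧ 0 ≤ l ∧
    (∀ X W : V, c * ‖W‖ ^ 2 ≤ 1 / 2 * ⟪D.κ W, W⟫ + ⟪D.R X, W⟫ + A * ‖X‖ ^ 2) ∧
    ∀ (X W : V) (p : H), c * (‖p‖ ^ 2 + ‖W‖ ^ 2) ≤
      ⟪D.ρ p, p⟫ + ⟪D.μ (D.S W), p⟫ - ⟪D.R W, W⟫ - 2 * A * ⟪X, W⟫
        + l * (1 / 2 * ⟪D.κ W, W⟫ + ⟪D.R X, W⟫ + A * ‖X‖ ^ 2) := by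
  obtain ⟨ρ₀, hρ₀, hρ⟩ := hD.ρ_pos
  obtain ⟨κ₀, hκ₀, hκ⟩ := hD.κ_pos
  set N := ‖D.R‖ with hN
  have hN0 : 0 ≤ N := norm_nonneg _
  set m := ‖D.μ‖ * ‖D.S‖ with hm
  have hm0 : 0 ≤ m := by positivity
  set A := N ^ 2 / κ₀ + 1 with hA
  have hA0 : 0 ≤ A := by positivity
  set l := A + 4 / κ₀ * (N + A + m ^ 2 / (2 * ρ₀) + 1) with hl
  have hl0 : 0 ≤ l := by positivity
  have hR : ∀ X W : V, |⟪D.R X, W⟫| ≤ N * (‖X‖ * ‖W‖) := fun X W =>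
    (abs_real_inner_le_norm _ _).trans <| by
      rw [← mul_assoc]; gcongr; exact D.R.le_opNorm X
  have hQ : ∀ X W : V,
      κ₀ / 4 * ‖W‖ ^ 2 + ‖X‖ ^ 2 ≤ 1 / 2 * ⟪D.κ W, W⟫ + ⟪D.R X, W⟫ + A * ‖X‖ ^ 2 := by
    intro X W
    have h1 := (abs_le.1 (hR X W)).1
    have h2 := hκ W
    have h3 : N * (‖X‖ * ‖W‖) ≤ κ₀ / 4 * ‖W‖ ^ 2 + N ^ 2 / κ₀ * ‖X‖ ^ 2 := by
      have : κ₀ / 4 * ‖W‖ ^ 2 + N ^ 2 / κ₀ * ‖X‖ ^ 2 - N * (‖X‖ * ‖W‖) =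
          (κ₀ / 2 * ‖W‖ - N * ‖X‖) ^ 2 / κ₀ := by field_simp; ring
      have h4 : 0 ≤ (κ₀ / 2 * ‖W‖ - N * ‖X‖) ^ 2 / κ₀ := by positivity
      linarith
    rw [hA]; linarith
  refine ⟨A, l, min (κ₀ / 4) (min (ρ₀ / 2) 1), by positivity, hl0, ?_, ?_⟩
  · intro X W
    have h1 := hQ X W
    have h2 : min (κ₀ / 4) (min (ρ₀ / 2) 1) * ‖W‖ ^ 2 ≤ κ₀ / 4 * ‖W‖ ^ 2 := by
      gcongr; exact min_le_left _ _
    nlinarith [sq_nonneg ‖X‖]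
  · intro X W p
    have hc1 : min (κ₀ / 4) (min (ρ₀ / 2) 1) ≤ ρ₀ / 2 := (min_le_right _ _).trans (min_le_left _ _)
    have hc2 : min (κ₀ / 4) (min (ρ₀ / 2) 1) ≤ 1 := (min_le_right _ _).trans (min_le_right _ _)
    have h0 : min (κ₀ / 4) (min (ρ₀ / 2) 1) * (‖p‖ ^ 2 + ‖W‖ ^ 2) ≤
        ρ₀ / 2 * ‖p‖ ^ 2 + 1 * ‖W‖ ^ 2 := by
      rw [mul_add]; gcongr
    have h1 := mul_le_mul_of_nonneg_left (hQ X W) hl0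
    have h2 := (abs_le.1 (hR W W)).2
    have h3 : |⟪D.μ (D.S W), p⟫| ≤ m * (‖W‖ * ‖p‖) :=
      (abs_real_inner_le_norm _ _).trans <| by
        rw [← mul_assoc]; gcongr
        rw [hm, mul_assoc]
        exact (D.μ.le_opNorm _).trans (by gcongr; exact D.S.le_opNorm W)
    have h4 : m * (‖W‖ * ‖p‖) ≤ ρ₀ / 2 * ‖p‖ ^ 2 + m ^ 2 / (2 * ρ₀) * ‖W‖ ^ 2 := by
      have : ρ₀ / 2 * ‖p‖ ^ 2 + m ^ 2 / (2 * ρ₀) * ‖W‖ ^ 2 - m * (‖W‖ * ‖p‖) =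
          (ρ₀ * ‖p‖ - m * ‖W‖) ^ 2 / (2 * ρ₀) := by field_simp; ring
      have h4 : 0 ≤ (ρ₀ * ‖p‖ - m * ‖W‖) ^ 2 / (2 * ρ₀) := by positivity
      linarith
    have h5 : 2 * A * ⟪X, W⟫ ≤ A * ‖X‖ ^ 2 + A * ‖W‖ ^ 2 := by
      have h6 := real_inner_le_norm X W
      have h7 := two_mul_le_add_sq ‖X‖ ‖W‖
      nlinarith
    have h6 : l * (κ₀ / 4 * ‖W‖ ^ 2 + ‖X‖ ^ 2) =
        A * (κ₀ / 4) * ‖W‖ ^ 2 + (N + A + m ^ 2 / (2 * ρ₀) + 1) * ‖W‖ ^ 2 + l * ‖X‖ ^ 2 := by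
      rw [hl]; field_simp
    have h7 : A * ‖X‖ ^ 2 ≤ l * ‖X‖ ^ 2 := by
      gcongr
      rw [hl]
      have : 0 ≤ 4 / κ₀ * (N + A + m ^ 2 / (2 * ρ₀) + 1) := by positivity
      linarith
    have h8 : 0 ≤ A * (κ₀ / 4) * ‖W‖ ^ 2 := by positivity
    have h9 := hρ p
    have h10 := (abs_le.1 h3).1
    nlinarith

/-- The energy estimate. -/
theorem exists_energy_bound (hD : D.Coercive) {T : ℝ} (hT : 0 ≤ T) : ∃ l c : ℝ, 0 < c ∧
    ∀ Ψ W X : ℝ → V, Continuous Ψ → (∀ t, HasDerivAt W (Ψ t) t) → (∀ t, HasDerivAt X (W t) t) →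
      W 0 = 0 → X 0 = 0 →
      c * (‖W T‖ ^ 2 + (∫ t in (0 : ℝ)..T, ‖D.S (Ψ t)‖ ^ 2) + ∫ t in (0 : ℝ)..T, ‖W t‖ ^ 2) ≤
        ∫ t in (0 : ℝ)..T, Real.exp (-l * t) * (⟪D.ρ (D.S (Ψ t)), D.S (Ψ t)⟫
          + ⟪D.μ (D.S (W t)), D.S (Ψ t)⟫ + ⟪D.R (X t), Ψ t⟫ + ⟪D.κ (W t), Ψ t⟫) := by
  obtain ⟨A, l, c, hc, hl, hQ, hG⟩ := D.exists_weights hD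
  refine ⟨l, c * Real.exp (-l * T), by positivity, ?_⟩
  intro Ψ W X hΨ hW hX hW0 hX0
  have hWc : Continuous W := continuous_iff_continuousAt.2 fun t => (hW t).continuousAt
  have hXc : Continuous X := continuous_iff_continuousAt.2 fun t => (hX t).continuousAt
  let Q : ℝ → ℝ := fun t => 1 / 2 * ⟪D.κ (W t), W t⟫ + ⟪D.R (X t), W t⟫ + A * ‖X t‖ ^ 2
  let G : ℝ → ℝ := fun t => ⟪D.ρ (D.S (Ψ t)), D.S (Ψ t)⟫ + ⟪D.μ (D.S (W t)), D.S (Ψ t)⟫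
    - ⟪D.R (W t), W t⟫ - 2 * A * ⟪X t, W t⟫ + l * Q t
  let E' : ℝ → ℝ := fun t => Real.exp (-l * t) * (⟪D.κ (W t), Ψ t⟫ + ⟪D.R (X t), Ψ t⟫
    + ⟪D.R (W t), W t⟫ + 2 * A * ⟪X t, W t⟫ - l * Q t)
  have hQd : ∀ t, HasDerivAt Q (⟪D.κ (W t), Ψ t⟫ + ⟪D.R (X t), Ψ t⟫
    + ⟪D.R (W t), W t⟫ + 2 * A * ⟪X t, W t⟫) t := by
    intro t
    have h1 := (((D.κ.hasFDerivAt.comp_hasDerivAt t (hW t)).inner ℝ (hW t)).const_mul (1 / 2)).add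
      ((D.R.hasFDerivAt.comp_hasDerivAt t (hX t)).inner ℝ (hW t))
    have h2 := h1.add ((hX t).norm_sq.const_mul A)
    refine h2.congr_deriv ?_
    simp only [Function.comp]
    rw [hD.κ_symm (Ψ t) (W t)]
    ring
  have hE : ∀ t, HasDerivAt (fun t => Real.exp (-l * t) * Q t) (E' t) t := by
    intro t
    have h1 : HasDerivAt (fun t => Real.exp (-l * t)) (Real.exp (-l * t) * (-l * 1)) t :=
      ((hasDerivAt_id t).const_mul (-l)).exp
    refine (h1.mul (hQd t)).congr_deriv ?_
    simp only [E']
    ring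
  have hQc : Continuous Q := continuous_iff_continuousAt.2 fun t => (hQd t).continuousAt
  have hE'c : Continuous E' := by fun_prop
  have hGc : Continuous G := by fun_prop
  have hint : ∫ t in (0 : ℝ)..T, E' t = Real.exp (-l * T) * Q T := by
    rw [intervalIntegral.integral_eq_sub_of_hasDerivAt (fun t _ => hE t)
      (hE'c.intervalIntegrable 0 T)]
    simp [Q, hW0, hX0]
  have hsum : ∫ t in (0 : ℝ)..T, Real.exp (-l * t) * (⟪D.ρ (D.S (Ψ t)), D.S (Ψ t)⟫
          + ⟪D.μ (D.S (W t)), D.S (Ψ t)⟫ + ⟪D.R (X t), Ψ t⟫ + ⟪D.κ (W t), Ψ t⟫) =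
      Real.exp (-l * T) * Q T + ∫ t in (0 : ℝ)..T, Real.exp (-l * t) * G t := by
    rw [← hint, ← intervalIntegral.integral_add (hE'c.intervalIntegrable 0 T)
      (Continuous.intervalIntegrable (by fun_prop) 0 T)]
    congr 1
    ext t
    simp only [E', G]
    ring
  have hlow : ∫ t in (0 : ℝ)..T, (c * Real.exp (-l * T)) * (‖D.S (Ψ t)‖ ^ 2 + ‖W t‖ ^ 2) ≤
      ∫ t in (0 : ℝ)..T, Real.exp (-l * t) * G t := by
    refine intervalIntegral.integral_mono_on hT (Continuous.intervalIntegrable (by fun_prop) 0 T)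
      (Continuous.intervalIntegrable (by fun_prop) 0 T) ?_
    intro t ht
    have h1 := hG (X t) (W t) (D.S (Ψ t))
    have h2 : Real.exp (-l * T) ≤ Real.exp (-l * t) := by
      apply Real.exp_le_exp.2; nlinarith [ht.2]
    calc (c * Real.exp (-l * T)) * (‖D.S (Ψ t)‖ ^ 2 + ‖W t‖ ^ 2)
        = Real.exp (-l * T) * (c * (‖D.S (Ψ t)‖ ^ 2 + ‖W t‖ ^ 2)) := by ring
      _ ≤ Real.exp (-l * t) * G t := by
        gcongr
  rw [intervalIntegral.integral_const_mul, intervalIntegral.integral_add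
    (Continuous.intervalIntegrable (by fun_prop) 0 T)
    (Continuous.intervalIntegrable (by fun_prop) 0 T)] at hlow
  rw [hsum]
  have h3 := hQ (X T) (W T)
  have h4 : c * Real.exp (-l * T) * ‖W T‖ ^ 2 ≤ Real.exp (-l * T) * Q T := by
    calc _ = Real.exp (-l * T) * (c * ‖W T‖ ^ 2) := by ring
      _ ≤ _ := by gcongr
  linarith

end DampedSystem

section Estimates

variable {V : Type*} [NormedAddCommGroup V] [InnerProductSpace ℝ V] [CompleteSpace V] {T : ℝ}

theorem integral_norm_mul_norm_le_sqrt {E F : Type*} [NormedAddCommGroup E]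
    [NormedAddCommGroup F] {α : Type*} [MeasurableSpace α] {m : Measure α} {f : α → E}
    {g : α → F} (hf : MemLp f 2 m) (hg : MemLp g 2 m) :
    ∫ t, ‖f t‖ * ‖g t‖ ∂m ≤ Real.sqrt (∫ t, ‖f t‖ ^ 2 ∂m) * Real.sqrt (∫ t, ‖g t‖ ^ 2 ∂m) := by
  have h := integral_mul_norm_le_Lp_mul_Lq (f := fun t => ‖f t‖) (g := fun t => ‖g t‖) (μ := m)
    Real.HolderConjugate.two_two (by simpa using hf.norm) (by simpa using hg.norm)
  simpa [Real.sqrt_eq_rpow] using h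

theorem norm_sq_eq_integral {E : Type*} [NormedAddCommGroup E] [InnerProductSpace ℝ E]
    {α : Type*} [MeasurableSpace α] {m : Measure α} {f : α → E} (hf : MemLp f 2 m) :
    ‖hf.toLp f‖ ^ 2 = ∫ t, ‖f t‖ ^ 2 ∂m := by
  rw [← real_inner_self_eq_norm_sq, MeasureTheory.L2.inner_def]
  refine integral_congr_ae ?_
  filter_upwards [hf.coeFn_toLp] with t ht
  rw [ht, real_inner_self_eq_norm_sq]

/-- A load `h b` with `h = ∫ k` is controlled by primitives of the test functions. -/
theorem exists_load_bound (b : V) (l : ℝ) (hT : 0 ≤ T) {k : ℝ → ℝ}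
    (hk : MemLp k 2 (volume.restrict (Ioo 0 T))) : ∃ C : ℝ, 0 ≤ C ∧
    ∀ Ψ W : ℝ → V, Continuous Ψ → (∀ t, HasDerivAt W (Ψ t) t) →
      |∫ t in Ioo 0 T, Real.exp (-l * t) * ((∫ s in (0 : ℝ)..t, k s) * ⟪b, Ψ t⟫)| ≤
        C * (‖W T‖ + Real.sqrt (∫ t in Ioo 0 T, ‖W t‖ ^ 2)) := by
  set M := Real.exp (|l| * T) * ‖b‖ with hM
  have hM0 : 0 ≤ M := by positivity
  set K1 := ∫ t in Ioo 0 T, ‖k t‖ with hK1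
  have hK10 : 0 ≤ K1 := integral_nonneg fun _ => norm_nonneg _
  set K2 := Real.sqrt (∫ t in Ioo 0 T, ‖k t‖ ^ 2) with hK2
  have hK20 : 0 ≤ K2 := Real.sqrt_nonneg _
  refine ⟨M * (K1 + K2 + |l| * Real.sqrt T * K1), by positivity, ?_⟩
  intro Ψ W hΨ hW
  have hWc : Continuous W := continuous_iff_continuousAt.2 fun t => (hW t).continuousAt
  set n := Real.sqrt (∫ t in Ioo 0 T, ‖W t‖ ^ 2) with hn
  have hn0 : 0 ≤ n := Real.sqrt_nonneg _
  have hexp : ∀ t ∈ Icc 0 T, Real.exp (-l * t) ≤ Real.exp (|l| * T) := by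
    intro t ht
    apply Real.exp_le_exp.2
    have h1 := neg_abs_le l
    have h2 := abs_nonneg l
    nlinarith [ht.1, ht.2, mul_le_mul_of_nonneg_left ht.2 h2]
  have hbd : ∀ t ∈ Icc 0 T, |Real.exp (-l * t) * ⟪b, W t⟫| ≤ M * ‖W t‖ := by
    intro t ht
    rw [abs_mul, abs_of_pos (Real.exp_pos _), hM, mul_assoc]
    exact mul_le_mul (hexp t ht) (abs_real_inner_le_norm b (W t)) (abs_nonneg _) (Real.exp_pos _).le
  have hd : ∀ t, HasDerivAt (fun t => Real.exp (-l * t) * ⟪b, W t⟫)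
      (Real.exp (-l * t) * ⟪b, Ψ t⟫ - l * (Real.exp (-l * t) * ⟪b, W t⟫)) t := by
    intro t
    have h1 : HasDerivAt (fun t => Real.exp (-l * t)) (Real.exp (-l * t) * (-l * 1)) t :=
      ((hasDerivAt_id t).const_mul (-l)).exp
    have h2 : HasDerivAt (fun t => ⟪b, W t⟫) ⟪b, Ψ t⟫ t := by
      simpa using (hasDerivAt_const t b).inner ℝ (hW t)
    refine (h1.mul h2).congr_deriv ?_
    ring
  have hWL : MemLp W 2 (volume.restrict (Ioo 0 T)) := memLp_of_continuousOn_Icc hWc.continuousOn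
  have hW1 : ∫ t in Ioo 0 T, ‖W t‖ ≤ Real.sqrt T * n := by
    have := integral_norm_mul_norm_le_sqrt (memLp_const (1 : ℝ)) hWL
    simpa [hT, hn] using this
  have hkW : ∫ t in Ioo 0 T, ‖k t‖ * ‖W t‖ ≤ K2 * n := integral_norm_mul_norm_le_sqrt hk hWL
  have hprim : ∀ t ∈ Icc 0 T, |∫ s in t..T, Real.exp (-l * s) * ⟪b, Ψ s⟫| ≤
      M * (‖W T‖ + ‖W t‖ + |l| * (Real.sqrt T * n)) := by
    intro t ht
    have hdc : Continuous fun s =>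
        Real.exp (-l * s) * ⟪b, Ψ s⟫ - l * (Real.exp (-l * s) * ⟪b, W s⟫) := by fun_prop
    have h1 := intervalIntegral.integral_eq_sub_of_hasDerivAt (a := t) (b := T)
      (fun s _ => hd s) (hdc.intervalIntegrable t T)
    have hc1 : Continuous fun s => Real.exp (-l * s) * ⟪b, Ψ s⟫ := by fun_prop
    have hc2 : Continuous fun s => l * (Real.exp (-l * s) * ⟪b, W s⟫) := by fun_prop
    rw [intervalIntegral.integral_sub (hc1.intervalIntegrable t T) (hc2.intervalIntegrable t T),
      intervalIntegral.integral_const_mul] at h1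
    have hc3 : Continuous fun s => M * ‖W s‖ := by fun_prop
    have h2 : |∫ s in t..T, Real.exp (-l * s) * ⟪b, W s⟫| ≤ M * (Real.sqrt T * n) := by
      calc |∫ s in t..T, Real.exp (-l * s) * ⟪b, W s⟫|
          ≤ ∫ s in t..T, M * ‖W s‖ := by
            rw [← Real.norm_eq_abs]
            refine intervalIntegral.norm_integral_le_of_norm_le ht.2 ?_
              (hc3.intervalIntegrable t T)
            exact ae_of_all _ fun s hs => hbd s ⟨ht.1.trans hs.1.le, hs.2⟩
        _ ≤ ∫ s in (0 : ℝ)..T, M * ‖W s‖ := by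
            refine intervalIntegral.integral_mono_interval ht.1 ht.2 le_rfl
              (ae_of_all _ fun s => by positivity)
              (hc3.intervalIntegrable 0 T)
        _ ≤ M * (Real.sqrt T * n) := by
            rw [intervalIntegral.integral_const_mul, intervalIntegral_eq_setIntegral_Ioo hT]
            gcongr
    have h3 : ∫ s in t..T, Real.exp (-l * s) * ⟪b, Ψ s⟫ =
        Real.exp (-l * T) * ⟪b, W T⟫ - Real.exp (-l * t) * ⟪b, W t⟫
          + l * ∫ s in t..T, Real.exp (-l * s) * ⟪b, W s⟫ := by linarith
    rw [h3]
    have h4 : |l * ∫ s in t..T, Real.exp (-l * s) * ⟪b, W s⟫| ≤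
        |l| * (M * (Real.sqrt T * n)) := by
      rw [abs_mul]; gcongr
    have h5 := hbd T ⟨hT, le_rfl⟩
    have h6 := hbd t ht
    refine (abs_add_le _ _).trans ((add_le_add (abs_sub _ _) h4).trans ?_)
    linarith
  have hcont : Continuous fun t => Real.exp (-l * t) * ⟪b, Ψ t⟫ := by fun_prop
  have hfub := integral_inner_primitive hT
    (memLp_of_continuousOn_Icc (T := T) hcont.continuousOn).integrable_of_Ioo hk.integrable_of_Ioo
  have heq : ∫ t in Ioo 0 T, Real.exp (-l * t) * ((∫ s in (0 : ℝ)..t, k s) * ⟪b, Ψ t⟫) =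
      ∫ t in Ioo 0 T, ⟪∫ s in t..T, Real.exp (-l * s) * ⟪b, Ψ s⟫, k t⟫ := by
    rw [← hfub]
    congr 1
    ext t
    simp only [RCLike.inner_apply, conj_trivial]
    ring
  rw [heq]
  have hkint := hk.integrable_of_Ioo.norm
  have hkWint : Integrable (fun t => ‖k t‖ * ‖W t‖) (volume.restrict (Ioo 0 T)) :=
    hk.norm.integrable_mul hWL.norm
  calc |∫ t in Ioo 0 T, ⟪∫ s in t..T, Real.exp (-l * s) * ⟪b, Ψ s⟫, k t⟫|
      ≤ ∫ t in Ioo 0 T, (M * (‖W T‖ + |l| * (Real.sqrt T * n)) * ‖k t‖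
          + M * (‖k t‖ * ‖W t‖)) := by
        rw [← Real.norm_eq_abs]
        refine norm_integral_le_of_norm_le (Integrable.add
          (f := fun t => M * (‖W T‖ + |l| * (Real.sqrt T * n)) * ‖k t‖)
          (g := fun t => M * (‖k t‖ * ‖W t‖)) (hkint.const_mul _) (hkWint.const_mul _)) ?_
        filter_upwards [ae_restrict_mem measurableSet_Ioo] with t ht
        have h1 := hprim t (Ioo_subset_Icc_self ht)
        refine (abs_real_inner_le_norm _ _).trans ?_
        calc _ ≤ (M * (‖W T‖ + ‖W t‖ + |l| * (Real.sqrt T * n))) * ‖k t‖ := by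
              gcongr; exact h1
          _ = _ := by ring
    _ = M * (‖W T‖ + |l| * (Real.sqrt T * n)) * K1 + M * ∫ t in Ioo 0 T, ‖k t‖ * ‖W t‖ := by
        rw [integral_add (hkint.const_mul _) (hkWint.const_mul _), integral_const_mul,
          integral_const_mul]
    _ ≤ M * (‖W T‖ + |l| * (Real.sqrt T * n)) * K1 + M * (K2 * n) := by gcongr
    _ ≤ M * (K1 + K2 + |l| * Real.sqrt T * K1) * (‖W T‖ + n) := by
        have h1 : 0 ≤ M * K1 * n := by positivity
        have h2 : 0 ≤ M * K2 * ‖W T‖ := by positivity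
        have h3 : 0 ≤ M * (|l| * Real.sqrt T * K1) * ‖W T‖ := by positivity
        linarith

/-- Weighted continuous functions are dense in `L²(0, T; V)`. -/
theorem dense_exp_smul_continuous (l : ℝ) :
    Dense {y : BochnerL2 V T | ∃ Ψ : ℝ → V, Continuous Ψ ∧
      y =ᵐ[volume.restrict (Ioo 0 T)] fun t => Real.exp (-l * t) • Ψ t} := by
  refine (BoundedContinuousFunction.toLp_denseRange V (volume.restrict (Ioo 0 T)) ℝ
    (p := 2) (by norm_num)).mono ?_
  rintro _ ⟨f, rfl⟩
  refine ⟨fun t => Real.exp (l * t) • f t, by fun_prop, ?_⟩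
  filter_upwards [BoundedContinuousFunction.coeFn_toLp (𝕜 := ℝ) (p := 2)
    (volume.restrict (Ioo 0 T)) f] with t ht
  rw [ht, smul_smul, ← Real.exp_add]
  simp

end Estimates

namespace DampedSystem

variable {V H : Type*} [NormedAddCommGroup V] [InnerProductSpace ℝ V] [CompleteSpace V]
  [NormedAddCommGroup H] [InnerProductSpace ℝ H] [CompleteSpace H] (D : DampedSystem V H)

/-- The compatibility defect of an acceleration and a velocity. -/
def defect (T : ℝ) : WithLp 2 (BochnerL2 H T × BochnerL2 V T) →L[ℝ] BochnerL2 H T :=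
  D.S.compLpL 2 (volume.restrict (Ioo 0 T)) ∘L WithLp.sndL 2 ℝ _ _
    - volterra H T ∘L WithLp.fstL 2 ℝ _ _

/-- Compatible pairs of an acceleration and a velocity. -/
def statePairs (T : ℝ) : Submodule ℝ (WithLp 2 (BochnerL2 H T × BochnerL2 V T)) :=
  LinearMap.ker (D.defect T).toLinearMap

instance (T : ℝ) : CompleteSpace (D.statePairs T) :=
  (D.defect T).isClosed_ker.completeSpace_coe

/-- The left hand side of the equation. -/
def stateOp (T : ℝ) : D.statePairs T →L[ℝ] BochnerL2 V T :=
  ((D.S.adjoint ∘L D.ρ).compLpL 2 (volume.restrict (Ioo 0 T)) ∘L WithLp.fstL 2 ℝ _ _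
    + ((D.S.adjoint ∘L D.μ ∘L D.S + D.κ).compLpL 2 (volume.restrict (Ioo 0 T))
      + D.R.compLpL 2 (volume.restrict (Ioo 0 T)) ∘L volterra V T) ∘L WithLp.sndL 2 ℝ _ _)
    ∘L (D.statePairs T).subtypeL

theorem mem_statePairs {T : ℝ} {P : BochnerL2 H T} {U : BochnerL2 V T} :
    WithLp.toLp 2 (P, U) ∈ D.statePairs T ↔
      ∀ᵐ t ∂(volume.restrict (Ioo 0 T)), D.S (U t) = ∫ s in (0 : ℝ)..t, P s := by
  have h1 : WithLp.toLp 2 (P, U) ∈ D.statePairs T ↔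
      D.S.compLpL 2 (volume.restrict (Ioo 0 T)) U - volterra H T P = 0 := Iff.rfl
  rw [h1, sub_eq_zero, Lp.ext_iff]
  constructor
  · intro h
    filter_upwards [h, D.S.coeFn_compLpL U, coeFn_volterra P] with t h1 h2 h3
    rw [← h2, h1, h3]
  · intro h
    filter_upwards [h, D.S.coeFn_compLpL U, coeFn_volterra P] with t h1 h2 h3
    rw [h2, h1, h3]

theorem coeFn_stateOp {T : ℝ} (z : D.statePairs T) :
    D.stateOp T z =ᵐ[volume.restrict (Ioo 0 T)] fun t =>
      D.S.adjoint (D.ρ (z.1.fst t)) + D.S.adjoint (D.μ (D.S (z.1.snd t)))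
        + D.R (∫ s in (0 : ℝ)..t, z.1.snd s) + D.κ (z.1.snd t) := by
  set L1 := (D.S.adjoint ∘L D.ρ).compLpL 2 (volume.restrict (Ioo 0 T)) z.1.fst with hL1
  set L2' := (D.S.adjoint ∘L D.μ ∘L D.S + D.κ).compLpL 2 (volume.restrict (Ioo 0 T)) z.1.snd
    with hL2
  set L3 := D.R.compLpL 2 (volume.restrict (Ioo 0 T)) (volterra V T z.1.snd) with hL3
  have h0 : D.stateOp T z = L1 + (L2' + L3) := rfl
  rw [h0]
  filter_upwards [(D.S.adjoint ∘L D.ρ).coeFn_compLpL z.1.fst,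
    (D.S.adjoint ∘L D.μ ∘L D.S + D.κ).coeFn_compLpL z.1.snd,
    D.R.coeFn_compLpL (volterra V T z.1.snd), coeFn_volterra z.1.snd,
    Lp.coeFn_add L1 (L2' + L3), Lp.coeFn_add L2' L3] with t h1 h2 h3 h4 h5 h6
  rw [h5, Pi.add_apply, h6, Pi.add_apply, hL1, hL2, hL3, h1, h2, h3, h4]
  simp only [ContinuousLinearMap.comp_apply, add_apply]
  abel

/-- Existence of solutions with two square integrable derivatives. -/
theorem exists_isSol (hD : D.Coercive) {T : ℝ} (hT : 0 ≤ T) {k : ℝ → ℝ}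
    (hk : MemLp k 2 (volume.restrict (Ioo 0 T))) :
    ∃ U P, D.IsSol T (fun t => ∫ s in (0 : ℝ)..t, k s) U P := by
  have hh : MemLp (fun t => (∫ s in (0 : ℝ)..t, k s) • D.b) 2 (volume.restrict (Ioo 0 T)) :=
    memLp_of_continuousOn_Icc
      ((continuousOn_primitive_of_Ioo hk.integrable_of_Ioo).smul continuousOn_const)
  obtain ⟨l, c, hc, henergy⟩ := D.exists_energy_bound hD hT
  obtain ⟨C, hC, hload⟩ := exists_load_bound D.b l hT hk
  obtain ⟨z, hz⟩ := (D.stateOp T).exists_apply_eq_of_inner_le (hh.toLp _) (C * (2 / c))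
    (dense_exp_smul_continuous (V := V) (T := T) l) <| by
    rintro y ⟨Ψ, hΨ, hy⟩
    let W : ℝ → V := fun t => ∫ s in (0 : ℝ)..t, Ψ s
    let X : ℝ → V := fun t => ∫ s in (0 : ℝ)..t, W s
    have hW : ∀ t, HasDerivAt W (Ψ t) t := fun t => hΨ.integral_hasStrictDerivAt 0 t |>.hasDerivAt
    have hWc : Continuous W := continuous_iff_continuousAt.2 fun t => (hW t).continuousAt
    have hX : ∀ t, HasDerivAt X (W t) t := fun t => hWc.integral_hasStrictDerivAt 0 t |>.hasDerivAt
    have hSΨc : Continuous fun t => D.S (Ψ t) := by fun_prop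
    have hSΨ : MemLp (fun t => D.S (Ψ t)) 2 (volume.restrict (Ioo 0 T)) :=
      memLp_of_continuousOn_Icc hSΨc.continuousOn
    have hWL : MemLp W 2 (volume.restrict (Ioo 0 T)) :=
      memLp_of_continuousOn_Icc hWc.continuousOn
    let z : D.statePairs T := ⟨WithLp.toLp 2 (hSΨ.toLp _, hWL.toLp _), by
      rw [mem_statePairs]
      filter_upwards [hWL.coeFn_toLp, ae_restrict_mem measurableSet_Ioo] with t h1 ht
      rw [h1, intervalIntegral_congr_of_ae_Ioo hSΨ.coeFn_toLp (Ioo_subset_Icc_self ht)]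
      exact (D.S.intervalIntegral_comp_comm (hΨ.intervalIntegrable 0 t)).symm⟩
    have hznorm : ‖z‖ ^ 2 = (∫ t in Ioo 0 T, ‖D.S (Ψ t)‖ ^ 2) + ∫ t in Ioo 0 T, ‖W t‖ ^ 2 := by
      rw [Submodule.coe_norm, WithLp.prod_norm_sq_eq_of_L2]
      exact congrArg₂ _ (norm_sq_eq_integral hSΨ) (norm_sq_eq_integral hWL)
    have hpair : ⟪D.stateOp T z, y⟫ = ∫ t in (0 : ℝ)..T, Real.exp (-l * t) *
        (⟪D.ρ (D.S (Ψ t)), D.S (Ψ t)⟫ + ⟪D.μ (D.S (W t)), D.S (Ψ t)⟫ + ⟪D.R (X t), Ψ t⟫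
          + ⟪D.κ (W t), Ψ t⟫) := by
      rw [MeasureTheory.L2.inner_def, intervalIntegral_eq_setIntegral_Ioo hT]
      refine integral_congr_ae ?_
      filter_upwards [D.coeFn_stateOp z, hy, hSΨ.coeFn_toLp, hWL.coeFn_toLp,
        ae_restrict_mem measurableSet_Ioo] with t h1 h2 h3 h4 ht
      rw [h1, h2]
      have h5 : z.1.fst t = D.S (Ψ t) := h3
      have h6 : z.1.snd t = W t := h4
      have h7 : ∫ s in (0 : ℝ)..t, z.1.snd s = X t :=
        intervalIntegral_congr_of_ae_Ioo hWL.coeFn_toLp (Ioo_subset_Icc_self ht)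
      rw [h5, h6, h7, real_inner_smul_right, inner_add_left, inner_add_left, inner_add_left,
        ContinuousLinearMap.adjoint_inner_left, ContinuousLinearMap.adjoint_inner_left]
    have hlow := henergy Ψ W X hΨ hW hX (by simp [W]) (by simp [X])
    rw [← hpair, intervalIntegral_eq_setIntegral_Ioo hT, intervalIntegral_eq_setIntegral_Ioo hT,
      add_assoc, ← hznorm] at hlow
    have hup : ⟪D.stateOp T z, y⟫ ≤ ‖z‖ * ‖(D.stateOp T).adjoint y‖ := by
      rw [← ContinuousLinearMap.adjoint_inner_right]
      exact real_inner_le_norm _ _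
    have hb : ⟪hh.toLp _, y⟫ = ∫ t in Ioo 0 T, Real.exp (-l * t) *
        ((∫ s in (0 : ℝ)..t, k s) * ⟪D.b, Ψ t⟫) := by
      rw [MeasureTheory.L2.inner_def]
      refine integral_congr_ae ?_
      filter_upwards [hh.coeFn_toLp, hy] with t h1 h2
      rw [h1, h2, real_inner_smul_left, real_inner_smul_right]
      ring
    rw [hb, mul_assoc]
    refine (hload Ψ W hΨ hW).trans (mul_le_mul_of_nonneg_left ?_ hC)
    set a := ‖(D.stateOp T).adjoint y‖
    set n := Real.sqrt (∫ t in Ioo 0 T, ‖W t‖ ^ 2) with hn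
    have hn2 : n ^ 2 ≤ ‖z‖ ^ 2 := by
      rw [hn, Real.sq_sqrt (integral_nonneg fun _ => by positivity), hznorm]
      have : 0 ≤ ∫ t in Ioo 0 T, ‖D.S (Ψ t)‖ ^ 2 := integral_nonneg fun _ => by positivity
      linarith
    have ha : 0 ≤ a := norm_nonneg _
    have hza : c * ‖z‖ ≤ a := by
      rcases (norm_nonneg z).eq_or_lt with h0 | h0
      · rw [← h0, mul_zero]; exact ha
      · refine le_of_mul_le_mul_left ?_ h0
        nlinarith [sq_nonneg ‖W T‖]
    have hsq : (‖W T‖ + n) ^ 2 ≤ (2 / c * a) ^ 2 := by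
      have h1 : (‖W T‖ + n) ^ 2 ≤ 2 * (‖W T‖ ^ 2 + ‖z‖ ^ 2) := by
        nlinarith [sq_nonneg (‖W T‖ - n)]
      have h2 : c ^ 2 * (‖W T‖ ^ 2 + ‖z‖ ^ 2) ≤ a ^ 2 := by
        nlinarith [norm_nonneg z]
      rw [div_mul_eq_mul_div, div_pow, le_div_iff₀ (by positivity)]
      nlinarith
    exact (le_abs_self _).trans (abs_le_of_sq_le_sq hsq (by positivity))
  refine ⟨z.1.snd, z.1.fst, Lp.memLp _, Lp.memLp _, D.mem_statePairs.1 z.2, ?_⟩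
  filter_upwards [D.coeFn_stateOp z, hh.coeFn_toLp] with t h1 h2
  rw [← h1, hz, h2]

end DampedSystem

section Reflection

variable {E : Type*} [NormedAddCommGroup E] {T : ℝ}

theorem measurePreserving_reflect (T : ℝ) : MeasurePreserving (fun t : ℝ => T - t)
    (volume.restrict (Ioo 0 T)) (volume.restrict (Ioo 0 T)) := by
  have h := (Measure.measurePreserving_sub_left volume T).restrict_preimage
    (measurableSet_Ioo (a := (0 : ℝ)) (b := T))
  simpa using h

theorem ae_reflect {p : ℝ → Prop} (h : ∀ᵐ t ∂(volume.restrict (Ioo 0 T)), p t) :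
    ∀ᵐ t ∂(volume.restrict (Ioo 0 T)), p (T - t) :=
  (measurePreserving_reflect T).quasiMeasurePreserving.ae h

theorem MeasureTheory.MemLp.reflect {f : ℝ → E} (h : MemLp f 2 (volume.restrict (Ioo 0 T))) :
    MemLp (fun t => f (T - t)) 2 (volume.restrict (Ioo 0 T)) :=
  h.comp_measurePreserving (measurePreserving_reflect T)

theorem MeasureTheory.MemLp.integrable_real_inner {α : Type*} [MeasurableSpace α] {m : Measure α}
    [InnerProductSpace ℝ E] {f g : α → E} (hf : MemLp f 2 m)
    (hg : MemLp g 2 m) : Integrable (fun t => ⟪f t, g t⟫) m := by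
  refine (MeasureTheory.L2.integrable_inner (𝕜 := ℝ) (hf.toLp f) (hg.toLp g)).congr ?_
  filter_upwards [hf.coeFn_toLp, hg.coeFn_toLp] with t h1 h2
  rw [h1, h2]

theorem integral_add_four {α : Type*} [MeasurableSpace α] {m : Measure α} {f₁ f₂ f₃ f₄ : α → ℝ}
    (h₁ : Integrable f₁ m) (h₂ : Integrable f₂ m) (h₃ : Integrable f₃ m) (h₄ : Integrable f₄ m) :
    ∫ t, (f₁ t + f₂ t + f₃ t + f₄ t) ∂m =
      ∫ t, f₁ t ∂m + ∫ t, f₂ t ∂m + ∫ t, f₃ t ∂m + ∫ t, f₄ t ∂m := by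
  exact (integral_add ((h₁.add h₂).add h₃) h₄).trans (congrArg (· + _)
    ((integral_add (h₁.add h₂) h₃).trans (congrArg (· + _) (integral_add h₁ h₂))))

/-- Symmetry of the convolution. -/
theorem integral_inner_primitive_reflect [InnerProductSpace ℝ E] [CompleteSpace E] (hT : 0 ≤ T)
    (L : E →L[ℝ] E) (hL : ∀ x y, ⟪L x, y⟫ = ⟪L y, x⟫) {f g : ℝ → E}
    (hf : MemLp f 2 (volume.restrict (Ioo 0 T))) (hg : MemLp g 2 (volume.restrict (Ioo 0 T))) :
    ∫ t in Ioo 0 T, ⟪L (f t), ∫ s in (0 : ℝ)..(T - t), g s⟫ =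
      ∫ t in Ioo 0 T, ⟪L (g (T - t)), ∫ s in (0 : ℝ)..t, f s⟫ := by
  have h := integral_inner_primitive hT (L.comp_memLp' hg.reflect).integrable_of_Ioo
    hf.integrable_of_Ioo
  refine Eq.trans (setIntegral_congr_fun measurableSet_Ioo fun t ht => ?_) h.symm
  have h1 : ∫ s in t..T, L (g (T - s)) = L (∫ s in (0 : ℝ)..(T - t), g s) := by
    rw [intervalIntegral.integral_comp_sub_left (fun s => L (g s)) T, sub_self]
    exact L.intervalIntegral_comp_of_Ioo hg.integrable_of_Ioo
      ⟨by linarith [ht.2], by linarith [ht.1]⟩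
  simp only [Function.comp_apply]
  rw [h1, hL]

end Reflection

namespace DampedSystem

variable {V H : Type*} [NormedAddCommGroup V] [InnerProductSpace ℝ V] [CompleteSpace V]
  [NormedAddCommGroup H] [InnerProductSpace ℝ H] [CompleteSpace H] {D : DampedSystem V H}

/-- All the operators of the system are symmetric. -/
structure Symmetric (D : DampedSystem V H) : Prop where
  ρ_symm : ∀ p q, ⟪D.ρ p, q⟫ = ⟪D.ρ q, p⟫
  μ_symm : ∀ p q, ⟪D.μ p, q⟫ = ⟪D.μ q, p⟫
  R_symm : ∀ v w, ⟪D.R v, w⟫ = ⟪D.R w, v⟫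
  κ_symm : ∀ v w, ⟪D.κ v, w⟫ = ⟪D.κ w, v⟫

namespace IsSol

variable {T : ℝ} {h : ℝ → ℝ} {U : ℝ → V} {P : ℝ → H}

theorem S_primitive (hs : D.IsSol T h U P) {t : ℝ} (ht : t ∈ Icc 0 T) :
    D.S (∫ s in (0 : ℝ)..t, U s) = ∫ s in (0 : ℝ)..t, ∫ τ in (0 : ℝ)..s, P τ := by
  rw [← D.S.intervalIntegral_comp_of_Ioo hs.memLp_U.integrable_of_Ioo ht]
  exact intervalIntegral_congr_of_ae_Ioo hs.S_eq ht

/-- Solutions may be integrated in time. -/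
theorem primitive (hs : D.IsSol T h U P) :
    D.IsSol T (fun t => ∫ s in (0 : ℝ)..t, h s) (fun t => ∫ s in (0 : ℝ)..t, U s)
      (fun t => ∫ s in (0 : ℝ)..t, P s) where
  memLp_U := memLp_primitive hs.memLp_U.integrable_of_Ioo
  memLp_P := memLp_primitive hs.memLp_P.integrable_of_Ioo
  S_eq := by
    filter_upwards [ae_restrict_mem measurableSet_Ioo] with t ht
    exact hs.S_primitive (Ioo_subset_Icc_self ht)
  eqn := by
    filter_upwards [ae_restrict_mem measurableSet_Ioo] with t ht
    have ht' := Ioo_subset_Icc_self ht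
    have h0 : (0 : ℝ) ∈ Icc 0 T := ⟨le_rfl, ht.1.le.trans ht.2.le⟩
    have iP := hs.memLp_P.integrable_of_Ioo
    have iU := hs.memLp_U.integrable_of_Ioo
    have iW := (memLp_primitive iU).integrable_of_Ioo
    have key := intervalIntegral_congr_of_ae_Ioo hs.eqn ht'
    have i1 := ((D.S.adjoint ∘L D.ρ).integrable_comp iP).intervalIntegrable_of_Ioo h0 ht'
    have i2 := ((D.S.adjoint ∘L D.μ ∘L D.S).integrable_comp iU).intervalIntegrable_of_Ioo h0 ht'
    have i3 := (D.R.integrable_comp iW).intervalIntegrable_of_Ioo h0 ht'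
    have i4 := (D.κ.integrable_comp iU).intervalIntegrable_of_Ioo h0 ht'
    have e1 := (D.S.adjoint ∘L D.ρ).intervalIntegral_comp_of_Ioo iP ht'
    have e2 := (D.S.adjoint ∘L D.μ ∘L D.S).intervalIntegral_comp_of_Ioo iU ht'
    have e3 := D.R.intervalIntegral_comp_of_Ioo iW ht'
    have e4 := D.κ.intervalIntegral_comp_of_Ioo iU ht'
    simp only [ContinuousLinearMap.comp_apply] at i1 i2 i3 i4 e1 e2 e3 e4
    rw [← e1, ← e2, ← e3, ← e4, ← intervalIntegral.integral_smul_const,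
      ← intervalIntegral.integral_add i1 i2, ← intervalIntegral.integral_add (i1.add i2) i3,
      ← intervalIntegral.integral_add ((i1.add i2).add i3) i4]
    exact key

/-- Reciprocity between two solutions, one of them reversed in time. -/
theorem reciprocity (hD : D.Symmetric) (hT : 0 ≤ T) (hs : D.IsSol T h U P) {η : ℝ → ℝ}
    {Y : ℝ → V} {Q : ℝ → H} (hη : D.IsSol T η Y Q) :
    ∫ t in Ioo 0 T, h t * ⟪D.b, ∫ s in (0 : ℝ)..(T - t), Y s⟫ =
      ∫ t in Ioo 0 T, η (T - t) * ⟪D.b, ∫ s in (0 : ℝ)..t, U s⟫ := by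
  have mP := hs.memLp_P
  have mU := hs.memLp_U
  have mQ := hη.memLp_P
  have mY := hη.memLp_U
  have mJP := memLp_primitive mP.integrable_of_Ioo
  have mJU := memLp_primitive mU.integrable_of_Ioo
  have mJQ := memLp_primitive mQ.integrable_of_Ioo
  have mJY := memLp_primitive mY.integrable_of_Ioo
  have mSU := D.S.comp_memLp' mU
  have mSY := D.S.comp_memLp' mY
  have c1 := integral_inner_primitive_reflect hT D.ρ hD.ρ_symm mP mJQ
  have c2 := integral_inner_primitive_reflect hT D.ρ hD.ρ_symm mJP mQ
  have c3 := integral_inner_primitive_reflect hT D.μ hD.μ_symm mSU mSY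
  have c4 := integral_inner_primitive_reflect hT D.κ hD.κ_symm mU mY
  have l1 : (fun t => h t * ⟪D.b, ∫ s in (0 : ℝ)..(T - t), Y s⟫)
      =ᵐ[volume.restrict (Ioo 0 T)] fun t =>
      ⟪D.ρ (P t), ∫ s in (0 : ℝ)..(T - t), ∫ τ in (0 : ℝ)..s, Q τ⟫
        + ⟪D.μ (D.S (U t)), ∫ s in (0 : ℝ)..(T - t), D.S (Y s)⟫
        + ⟪D.R (∫ s in (0 : ℝ)..t, U s), ∫ s in (0 : ℝ)..(T - t), Y s⟫
        + ⟪D.κ (U t), ∫ s in (0 : ℝ)..(T - t), Y s⟫ := by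
    filter_upwards [hs.eqn, ae_restrict_mem measurableSet_Ioo] with t h1 ht
    have ht' : T - t ∈ Icc 0 T := ⟨by linarith [ht.2], by linarith [ht.1]⟩
    rw [← real_inner_smul_left, ← h1, inner_add_left, inner_add_left, inner_add_left,
      ContinuousLinearMap.adjoint_inner_left, ContinuousLinearMap.adjoint_inner_left,
      ← hη.S_primitive ht', D.S.intervalIntegral_comp_of_Ioo mY.integrable_of_Ioo ht']
  have l2 : (fun t => η (T - t) * ⟪D.b, ∫ s in (0 : ℝ)..t, U s⟫)
      =ᵐ[volume.restrict (Ioo 0 T)] fun t =>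
      ⟪D.ρ (Q (T - t)), ∫ s in (0 : ℝ)..t, ∫ τ in (0 : ℝ)..s, P τ⟫
        + ⟪D.μ (D.S (Y (T - t))), ∫ s in (0 : ℝ)..t, D.S (U s)⟫
        + ⟪D.R (∫ s in (0 : ℝ)..(T - t), Y s), ∫ s in (0 : ℝ)..t, U s⟫
        + ⟪D.κ (Y (T - t)), ∫ s in (0 : ℝ)..t, U s⟫ := by
    filter_upwards [ae_reflect hη.eqn, ae_restrict_mem measurableSet_Ioo] with t h1 ht
    have ht' := Ioo_subset_Icc_self ht
    rw [← real_inner_smul_left, ← h1, inner_add_left, inner_add_left, inner_add_left,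
      ContinuousLinearMap.adjoint_inner_left, ContinuousLinearMap.adjoint_inner_left,
      ← hs.S_primitive ht', D.S.intervalIntegral_comp_of_Ioo mU.integrable_of_Ioo ht']
  rw [integral_congr_ae l1, integral_congr_ae l2]
  have i1 := (D.ρ.comp_memLp' mP).integrable_real_inner
    (memLp_primitive mJQ.integrable_of_Ioo).reflect
  have i2 := (D.μ.comp_memLp' mSU).integrable_real_inner
    (memLp_primitive mSY.integrable_of_Ioo).reflect
  have i3 := (D.R.comp_memLp' mJU).integrable_real_inner mJY.reflect
  have i4 := (D.κ.comp_memLp' mU).integrable_real_inner mJY.reflect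
  have j1 := (D.ρ.comp_memLp' mQ.reflect).integrable_real_inner
    (memLp_primitive mJP.integrable_of_Ioo)
  have j2 := (D.μ.comp_memLp' mSY.reflect).integrable_real_inner
    (memLp_primitive mSU.integrable_of_Ioo)
  have j3 := (D.R.comp_memLp' mJY.reflect).integrable_real_inner mJU
  have j4 := (D.κ.comp_memLp' mY.reflect).integrable_real_inner mJU
  simp only [Function.comp_apply] at i1 i2 i3 i4 j1 j2 j3 j4 c3
  rw [integral_add_four i1 i2 i3 i4, integral_add_four j1 j2 j3 j4, c1, c3, c4, ← c2]
  have h1 : ∀ t, ⟪D.ρ (∫ s in (0 : ℝ)..(T - t), Q s), ∫ s in (0 : ℝ)..t, P s⟫ =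
      ⟪D.ρ (∫ s in (0 : ℝ)..t, P s), ∫ s in (0 : ℝ)..(T - t), Q s⟫ := fun t => hD.ρ_symm _ _
  have h2 : ∀ t, ⟪D.R (∫ s in (0 : ℝ)..t, U s), ∫ s in (0 : ℝ)..(T - t), Y s⟫ =
      ⟪D.R (∫ s in (0 : ℝ)..(T - t), Y s), ∫ s in (0 : ℝ)..t, U s⟫ := fun t => hD.R_symm _ _
  simp only [h1, h2]

end IsSol

end DampedSystem

/-! ### Sobolev functions as primitives -/

section Sobolev

variable {ℓ : ℝ}

/-- The constant function `1`. -/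
def L2.one (ℓ : ℝ) : L2 ℓ := (memLp_const (1 : ℝ)).toLp _

theorem L2.coeFn_one : L2.one ℓ =ᵐ[volume.restrict (Ioo 0 ℓ)] fun _ => (1 : ℝ) :=
  MemLp.coeFn_toLp _

theorem L2.inner_one (hℓ : 0 ≤ ℓ) (f : L2 ℓ) : ⟪L2.one ℓ, f⟫ = ∫ x in (0 : ℝ)..ℓ, f x := by
  rw [MeasureTheory.L2.inner_def, intervalIntegral_eq_setIntegral_Ioo hℓ]
  refine integral_congr_ae ?_
  filter_upwards [L2.coeFn_one (ℓ := ℓ)] with x hx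
  rw [hx]
  simp

/-- The primitive vanishing at `0`. -/
abbrev L2.prim (ℓ : ℝ) : L2 ℓ →L[ℝ] L2 ℓ := volterra ℝ ℓ

theorem L2.prim_injective : Function.Injective (L2.prim ℓ) := by
  intro f g h
  apply Lp.ext
  refine primitive_injective (Lp.memLp f).integrable_of_Ioo (Lp.memLp g).integrable_of_Ioo ?_
  filter_upwards [coeFn_volterra f, coeFn_volterra g] with x h1 h2
  rw [← h1, ← h2, h]

theorem hasWeakDeriv_prim (f : L2 ℓ) : HasWeakDeriv (L2.prim ℓ f) f :=
  ⟨0, by filter_upwards [coeFn_volterra f] with x h; rw [h, zero_add]⟩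

theorem HasWeakDeriv.eq_smul_one_add_prim (hℓ : 0 < ℓ) {f f' : L2 ℓ} (h : HasWeakDeriv f f') :
    f = contRep f f' 0 • L2.one ℓ + L2.prim ℓ f' := by
  obtain ⟨h1, h2⟩ := contRep_spec hℓ h
  apply Lp.ext
  filter_upwards [h2, Lp.coeFn_add (contRep f f' 0 • L2.one ℓ) (L2.prim ℓ f'),
    Lp.coeFn_smul (contRep f f' 0) (L2.one ℓ), L2.coeFn_one (ℓ := ℓ), coeFn_volterra f',
    ae_restrict_mem measurableSet_Ioo] with x e1 e2 e3 e4 e5 hx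
  rw [e1, e2, Pi.add_apply, e3, Pi.smul_apply, e4, e5, h1 x (Ioo_subset_Icc_self hx)]
  simp

theorem contRep_prim (hℓ : 0 < ℓ) (f : L2 ℓ) {x : ℝ} (hx : x ∈ Icc 0 ℓ) :
    contRep (L2.prim ℓ f) f x = ∫ y in (0 : ℝ)..x, f y := by
  obtain ⟨h1, h2⟩ := contRep_spec hℓ (hasWeakDeriv_prim f)
  suffices h : contRep (L2.prim ℓ f) f 0 = 0 by rw [h1 x hx, h, zero_add]
  have hne : (ae (volume.restrict (Ioo 0 ℓ))).NeBot := by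
    rw [ae_neBot, Ne, Measure.restrict_eq_zero]
    simp [hℓ]
  obtain ⟨y, e1, e2, hy⟩ :=
    (h2.and ((coeFn_volterra f).and (ae_restrict_mem measurableSet_Ioo))).exists
  rw [h1 y (Ioo_subset_Icc_self hy), e2] at e1
  linarith

namespace H2

/-- The derivatives are continuous. -/
def dxL (j : Fin 3) : H2 ℓ →L[ℝ] L2 ℓ :=
  PiLp.proj 2 (fun _ : Fin 3 => L2 ℓ) j ∘L (H2Submodule ℓ).subtypeL

/-- The clamped function with given second derivative. -/
def ofDx2 (ℓ : ℝ) : L2 ℓ →L[ℝ] H2 ℓ :=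
  ((PiLp.continuousLinearEquiv 2 ℝ (fun _ : Fin 3 => L2 ℓ)).symm.toContinuousLinearMap ∘L
    ContinuousLinearMap.pi ![L2.prim ℓ ∘L L2.prim ℓ, L2.prim ℓ,
      ContinuousLinearMap.id ℝ (L2 ℓ)]).codRestrict (H2Submodule ℓ)
    fun w => ⟨hasWeakDeriv_prim (L2.prim ℓ w), hasWeakDeriv_prim w⟩

@[simp] theorem dx_zero_ofDx2 (w : L2 ℓ) : (ofDx2 ℓ w).dx 0 = L2.prim ℓ (L2.prim ℓ w) := rfl

@[simp] theorem dx_two_ofDx2 (w : L2 ℓ) : (ofDx2 ℓ w).dx 2 = w := rfl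

theorem dx_one_eq (hℓ : 0 < ℓ) (v : H2 ℓ) :
    v.dx 1 = v.slope 0 • L2.one ℓ + L2.prim ℓ (v.dx 2) :=
  v.2.2.eq_smul_one_add_prim hℓ

theorem dx_zero_eq (hℓ : 0 < ℓ) (v : H2 ℓ) :
    v.dx 0 = v.val 0 • L2.one ℓ + L2.prim ℓ (v.dx 1) :=
  v.2.1.eq_smul_one_add_prim hℓ

theorem val_end_eq (hℓ : 0 < ℓ) (v : H2 ℓ) :
    v.val ℓ = v.val 0 + ⟪L2.one ℓ, v.dx 1⟫ := by
  rw [L2.inner_one hℓ.le]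
  exact (contRep_spec hℓ v.2.1).1 ℓ ⟨hℓ.le, le_rfl⟩

/-- The functional `v ↦ v(ℓ)` on clamped functions, in terms of `v_xx`. -/
def tipVector (ℓ : ℝ) : L2 ℓ := (L2.prim ℓ).adjoint (L2.one ℓ)

theorem val_end_eq_of_mem (hℓ : 0 < ℓ) {v : H2 ℓ} (h0 : v.val 0 = 0) :
    v.val ℓ = ℓ * v.slope 0 + ⟪tipVector ℓ, v.dx 2⟫ := by
  rw [val_end_eq hℓ, h0, zero_add, dx_one_eq hℓ, inner_add_right, inner_smul_right, tipVector,
    ContinuousLinearMap.adjoint_inner_left, L2.inner_one hℓ.le (L2.one ℓ),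
    intervalIntegral_congr_of_ae_Ioo L2.coeFn_one ⟨hℓ.le, le_rfl⟩]
  simp [mul_comm]

theorem ofDx2_mem_V (hℓ : 0 < ℓ) (w : L2 ℓ) : ofDx2 ℓ w ∈ V ℓ := by
  have h0 : (0 : ℝ) ∈ Icc 0 ℓ := ⟨le_rfl, hℓ.le⟩
  constructor
  · exact (contRep_prim hℓ (L2.prim ℓ w) h0).trans intervalIntegral.integral_same
  · exact (contRep_prim hℓ w h0).trans intervalIntegral.integral_same

theorem dx_zero_of_mem_V (hℓ : 0 < ℓ) {v : H2 ℓ} (hv : v ∈ V ℓ) :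
    v.dx 0 = L2.prim ℓ (L2.prim ℓ (v.dx 2)) := by
  rw [dx_zero_eq hℓ, dx_one_eq hℓ, hv.1, hv.2]
  simp

end H2

/-- The average of an adjoint primitive near `0`. -/
theorem tendsto_average_adjoint_prim (hℓ : 0 < ℓ) (k : L2 ℓ) :
    Tendsto (fun h : ℝ => h⁻¹ * ∫ x in (0 : ℝ)..h, (L2.prim ℓ).adjoint k x) (𝓝[>] 0)
      (𝓝 ⟪L2.one ℓ, k⟫) := by
  have ik := (Lp.memLp k).integrable_of_Ioo
  have h0 : (0 : ℝ) ∈ Icc 0 ℓ := ⟨le_rfl, hℓ.le⟩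
  have hl : ℓ ∈ Icc 0 ℓ := ⟨hℓ.le, le_rfl⟩
  let q : ℝ → ℝ := fun x => ∫ y in x..ℓ, k y
  have hq : ∀ x ∈ Icc 0 ℓ, q x = (∫ y in (0 : ℝ)..ℓ, k y) - ∫ y in (0 : ℝ)..x, k y := by
    intro x hx
    rw [intervalIntegral.integral_interval_sub_left (ik.intervalIntegrable_of_Ioo h0 hl)
      (ik.intervalIntegrable_of_Ioo h0 hx)]
  have hqc : ContinuousOn q (Icc 0 ℓ) :=
    (continuousOn_const.sub (continuousOn_primitive_of_Ioo ik)).congr hq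
  have mq : MemLp q 2 (volume.restrict (Ioo 0 ℓ)) := memLp_of_continuousOn_Icc hqc
  have hadj : (L2.prim ℓ).adjoint k = mq.toLp q := by
    refine ext_inner_right ℝ fun f => ?_
    rw [ContinuousLinearMap.adjoint_inner_left, MeasureTheory.L2.inner_def,
      MeasureTheory.L2.inner_def]
    have h := integral_inner_primitive hℓ.le ik (Lp.memLp f).integrable_of_Ioo
    refine Eq.trans (integral_congr_ae ?_) (h.trans (integral_congr_ae ?_))
    · filter_upwards [coeFn_volterra f] with x hx
      rw [hx]
    · filter_upwards [mq.coeFn_toLp] with x hx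
      rw [hx]
  have hderiv : HasDerivWithinAt (fun h => ∫ x in (0 : ℝ)..h, q x) (q 0) (Ioi 0) 0 := by
    have hcw : ContinuousWithinAt q (Ioi 0) 0 :=
      ((hqc 0 h0).mono Ioc_subset_Icc_self).mono_of_mem_nhdsWithin
        (Ioc_mem_nhdsGT hℓ)
    refine (intervalIntegral.integral_hasDerivWithinAt_right (s := Ici 0) (t := Ioi 0)
      (by simp) ?_ hcw).mono Ioi_subset_Ici_self
    exact ⟨Ioc 0 ℓ, Ioc_mem_nhdsGT hℓ,
      (hqc.mono Ioc_subset_Icc_self).aestronglyMeasurable measurableSet_Ioc⟩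
  rw [hasDerivWithinAt_iff_tendsto_slope' (by simp)] at hderiv
  have hq0 : q 0 = ⟪L2.one ℓ, k⟫ := (L2.inner_one hℓ.le k).symm
  rw [← hq0]
  refine hderiv.congr' ?_
  filter_upwards [Ioc_mem_nhdsGT hℓ] with h hh
  rw [slope_def_field, intervalIntegral.integral_same, sub_zero, sub_zero, div_eq_inv_mul, hadj,
    intervalIntegral_congr_of_ae_Ioo mq.coeFn_toLp ⟨hh.1.le, hh.2⟩]

/-- Multiplication by a bounded function. -/
theorem exists_mulOp {w : ℝ → ℝ} {c M : ℝ}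
    (hw : AEStronglyMeasurable w (volume.restrict (Ioo 0 ℓ)))
    (hb : ∀ᵐ x ∂(volume.restrict (Ioo 0 ℓ)), w x ∈ Icc c M) (hc : 0 ≤ c) :
    ∃ L : L2 ℓ →L[ℝ] L2 ℓ, (∀ f, L f =ᵐ[volume.restrict (Ioo 0 ℓ)] fun x => w x * f x) ∧
      (∀ f g, ⟪L f, g⟫ = ⟪L g, f⟫) ∧ ∀ f, c * ‖f‖ ^ 2 ≤ ⟪L f, f⟫ := by
  have hbound : ∀ f : L2 ℓ, ∀ᵐ x ∂(volume.restrict (Ioo 0 ℓ)), ‖w x * f x‖ ≤ M * ‖f x‖ := by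
    intro f
    filter_upwards [hb] with x hx
    rw [norm_mul, Real.norm_eq_abs, abs_of_nonneg (hc.trans hx.1)]
    gcongr
    exact hx.2
  have hmem : ∀ f : L2 ℓ, MemLp (fun x => w x * f x) 2 (volume.restrict (Ioo 0 ℓ)) := fun f =>
    (Lp.memLp f).of_le_mul (hw.mul (Lp.aestronglyMeasurable f)) (hbound f)
  let L : L2 ℓ →L[ℝ] L2 ℓ := LinearMap.mkContinuous
    { toFun := fun f => (hmem f).toLp _
      map_add' := by
        intro f g
        apply Lp.ext
        filter_upwards [(hmem f).coeFn_toLp, (hmem g).coeFn_toLp, (hmem (f + g)).coeFn_toLp,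
          Lp.coeFn_add ((hmem f).toLp _) ((hmem g).toLp _), Lp.coeFn_add f g] with x h1 h2 h3 h4 h5
        rw [h3, h4, Pi.add_apply, h1, h2, h5, Pi.add_apply, mul_add]
      map_smul' := by
        intro a f
        apply Lp.ext
        filter_upwards [(hmem f).coeFn_toLp, (hmem (a • f)).coeFn_toLp,
          Lp.coeFn_smul a ((hmem f).toLp _), Lp.coeFn_smul a f] with x h1 h2 h3 h4
        rw [h2, RingHom.id_apply, h3, Pi.smul_apply, h1, h4, Pi.smul_apply, smul_eq_mul,
          smul_eq_mul]
        ring } M <| by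
    intro f
    refine Lp.norm_le_mul_norm_of_ae_le_mul ?_
    filter_upwards [hbound f, (hmem f).coeFn_toLp] with x h1 h2
    have h3 : ((hmem f).toLp (fun x => w x * f x) : ℝ → ℝ) x = w x * f x := h2
    exact (congrArg norm h3).trans_le h1
  have hL : ∀ f, L f =ᵐ[volume.restrict (Ioo 0 ℓ)] fun x => w x * f x := fun f =>
    (hmem f).coeFn_toLp
  refine ⟨L, hL, fun f g => ?_, fun f => ?_⟩
  · rw [MeasureTheory.L2.inner_def, MeasureTheory.L2.inner_def]
    refine integral_congr_ae ?_
    filter_upwards [hL f, hL g] with x h1 h2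
    rw [h1, h2]
    simp only [RCLike.inner_apply, conj_trivial]
    ring
  · rw [← real_inner_self_eq_norm_sq, MeasureTheory.L2.inner_def, MeasureTheory.L2.inner_def,
      ← integral_const_mul]
    refine integral_mono_ae ((MeasureTheory.L2.integrable_inner f f).const_mul c)
      (MeasureTheory.L2.integrable_inner (L f) f) ?_
    filter_upwards [hL f, hb] with x h1 h2
    simp only [h1, RCLike.inner_apply, conj_trivial]
    nlinarith [mul_self_nonneg (f x), h2.1]

end Sobolev

/-! ### The beam as a damped system for the curvature -/

namespace Beam

variable {B : Beam}

/-- The damped system describes the beam in terms of the second derivative. -/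
structure IsSystem (B : Beam) (D : DampedSystem (L2 B.ℓ) (L2 B.ℓ)) : Prop where
  S_eq : D.S = L2.prim B.ℓ ∘L L2.prim B.ℓ
  b_eq : D.b = H2.tipVector B.ℓ
  ρ_eq : ∀ f, D.ρ f =ᵐ[volume.restrict (Ioo 0 B.ℓ)] fun x => B.ρ x * f x
  μ_eq : ∀ f, D.μ f =ᵐ[volume.restrict (Ioo 0 B.ℓ)] fun x => B.μ x * f x
  R_eq : ∀ f, D.R f =ᵐ[volume.restrict (Ioo 0 B.ℓ)] fun x => B.r x * f x
  κ_eq : ∀ f, D.κ f =ᵐ[volume.restrict (Ioo 0 B.ℓ)] fun x => B.κ x * f x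
  coercive : D.Coercive
  symmetric : D.Symmetric

theorem aestronglyMeasurable_of_memSobolev {L : ℝ} (hL : 0 ≤ L) {f : ℝ → ℝ}
    (hf : MemSobolev 2 L f) : AEStronglyMeasurable f (volume.restrict (Ioo 0 L)) := by
  have h := (hf.1 0 (by norm_num)).continuousOn
  rw [derivOn, iteratedDerivWithin_zero, uIcc_of_le hL] at h
  exact (h.mono Ioo_subset_Icc_self).aestronglyMeasurable measurableSet_Ioo

theorem Admissible.exists_isSystem (hB : B.Admissible) : ∃ D, B.IsSystem D := by
  have hℓ := hB.length_pos
  obtain ⟨ρ₀, ρ₁, hρ₀, hρ⟩ := hB.bound_ρ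
  obtain ⟨μ₀, μ₁, hμ₀, hμ⟩ := hB.bound_μ
  obtain ⟨r₀, r₁, hr₀, hr⟩ := hB.bound_r
  obtain ⟨κ₀, κ₁, hκ₀, hκ⟩ := hB.bound_κ
  obtain ⟨Lρ, hρ1, hρ2, hρ3⟩ := exists_mulOp hB.measurable_ρ hρ hρ₀.le
  obtain ⟨Lμ, hμ1, hμ2, hμ3⟩ := exists_mulOp hB.measurable_μ hμ hμ₀
  obtain ⟨Lr, hr1, hr2, hr3⟩ := exists_mulOp
    (aestronglyMeasurable_of_memSobolev hℓ.le hB.sobolev_r)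
    ((ae_restrict_iff' measurableSet_Ioo).2 (ae_of_all _ hr)) hr₀.le
  obtain ⟨Lκ, hκ1, hκ2, hκ3⟩ := exists_mulOp
    (aestronglyMeasurable_of_memSobolev hℓ.le hB.sobolev_κ)
    ((ae_restrict_iff' measurableSet_Ioo).2 (ae_of_all _ hκ)) hκ₀.le
  exact ⟨⟨L2.prim B.ℓ ∘L L2.prim B.ℓ, Lρ, Lμ, Lr, Lκ, H2.tipVector B.ℓ⟩, rfl, rfl, hρ1, hμ1, hr1,
    hκ1, ⟨⟨ρ₀, hρ₀, hρ3⟩, ⟨κ₀, hκ₀, hκ3⟩, hκ2⟩, ⟨hρ2, hμ2, hr2, hκ2⟩⟩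

theorem pair_eq_inner (hℓ : 0 ≤ B.ℓ) {w : ℝ → ℝ} {L : L2 B.ℓ →L[ℝ] L2 B.ℓ}
    (hL : ∀ f, L f =ᵐ[volume.restrict (Ioo 0 B.ℓ)] fun x => w x * f x) (f h : L2 B.ℓ) :
    B.pair w f h = ⟪L f, h⟫ := by
  rw [pair, intervalIntegral_eq_setIntegral_Ioo hℓ, MeasureTheory.L2.inner_def]
  refine integral_congr_ae ?_
  filter_upwards [hL f] with x hx
  rw [hx]
  simp only [RCLike.inner_apply, conj_trivial]
  ring

variable {D : DampedSystem (L2 B.ℓ) (L2 B.ℓ)} {T : ℝ} {g : ℝ → ℝ} {s : Motion B.ℓ}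

namespace IsWeakSolution

theorem memLp_curvature_rate (hs : B.IsWeakSolution T g s) :
    MemLp (fun t => (s.ut t).dx 2) 2 (volume.restrict (Ioo 0 T)) :=
  (H2.dxL 2).comp_memLp' hs.memLp_ut

theorem curvature_eq (hℓ : 0 < B.ℓ) (hs : B.IsWeakSolution T g s) :
    ∀ᵐ t ∂(volume.restrict (Ioo 0 T)), (s.u t).dx 2 = ∫ τ in (0 : ℝ)..t, (s.ut τ).dx 2 := by
  filter_upwards [hs.u_mem, hs.u_eq, ae_restrict_mem measurableSet_Ioo] with t h1 h2 ht
  apply L2.prim_injective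
  apply L2.prim_injective
  have ht' := Ioo_subset_Icc_self ht
  have h3 : ∫ τ in (0 : ℝ)..t, (s.ut τ).dx 0 =
      ∫ τ in (0 : ℝ)..t, (L2.prim B.ℓ ∘L L2.prim B.ℓ) ((s.ut τ).dx 2) := by
    refine intervalIntegral_congr_of_ae_Ioo ?_ ht'
    filter_upwards [hs.ut_mem] with τ h4
    exact H2.dx_zero_of_mem_V hℓ h4
  rw [← H2.dx_zero_of_mem_V hℓ h1, h2, h3, ContinuousLinearMap.intervalIntegral_comp_of_Ioo _
    hs.memLp_curvature_rate.integrable_of_Ioo ht', ContinuousLinearMap.comp_apply]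

theorem isSol (hℓ : 0 < B.ℓ) (hD : B.IsSystem D) (hs : B.IsWeakSolution T g s) :
    D.IsSol T g (fun t => (s.ut t).dx 2) s.utt where
  memLp_U := hs.memLp_curvature_rate
  memLp_P := hs.memLp_utt
  S_eq := by
    filter_upwards [hs.ut_mem, hs.ut_eq] with t h1 h2
    rw [← h2, H2.dx_zero_of_mem_V hℓ h1, hD.S_eq, ContinuousLinearMap.comp_apply]
  eqn := by
    filter_upwards [hs.weak_form, hs.curvature_eq hℓ, hs.ut_mem] with t h1 h2 h3
    rw [← h2]
    refine ext_inner_right ℝ fun w => ?_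
    have h4 := h1 (H2.ofDx2 B.ℓ w) (H2.ofDx2_mem_V hℓ w)
    rw [H2.val_end_eq_of_mem hℓ (H2.ofDx2_mem_V hℓ w).1, (H2.ofDx2_mem_V hℓ w).2, mul_zero,
      zero_add, pair_eq_inner hℓ.le hD.ρ_eq, pair_eq_inner hℓ.le hD.μ_eq,
      pair_eq_inner hℓ.le hD.R_eq, pair_eq_inner hℓ.le hD.κ_eq, H2.dx_zero_of_mem_V hℓ h3,
      H2.dx_zero_ofDx2, H2.dx_two_ofDx2, ← hD.b_eq] at h4
    rw [inner_add_left, inner_add_left, inner_add_left, ContinuousLinearMap.adjoint_inner_left,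
      ContinuousLinearMap.adjoint_inner_left, real_inner_smul_left, ← h4, hD.S_eq]
    rfl

theorem tip_eq (hℓ : 0 < B.ℓ) (hs : B.IsWeakSolution T g s) :
    ∀ᵐ t ∂(volume.restrict (Ioo 0 T)),
      B.tip s t = ⟪H2.tipVector B.ℓ, ∫ τ in (0 : ℝ)..t, (s.ut τ).dx 2⟫ := by
  filter_upwards [hs.u_mem, hs.curvature_eq hℓ] with t h1 h2
  rw [tip, H2.val_end_eq_of_mem hℓ h1.1, h1.2, h2, mul_zero, zero_add]

/-- The moment at the clamped end, by testing with the function `x`. -/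
theorem momentAtZero_eq (hℓ : 0 < B.ℓ) (hD : B.IsSystem D) (hs : B.IsWeakSolution T g s) :
    ∀ᵐ t ∂(volume.restrict (Ioo 0 T)), B.momentAtZero s t =
      g t * B.ℓ - ⟪D.ρ (s.utt t) + D.μ ((s.ut t).dx 0), L2.prim B.ℓ (L2.one B.ℓ)⟫ := by
  filter_upwards [(hs.isSol hℓ hD).eqn, hs.curvature_eq hℓ, hs.ut_mem] with t h1 h2 h3
  set F := D.ρ (s.utt t) + D.μ ((s.ut t).dx 0) with hF
  have h4 : D.R ((s.u t).dx 2) + D.κ ((s.ut t).dx 2) =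
      (L2.prim B.ℓ).adjoint (g t • L2.one B.ℓ - (L2.prim B.ℓ).adjoint F) := by
    rw [map_sub, map_smul]
    change _ = g t • H2.tipVector B.ℓ - _
    rw [← hD.b_eq, ← h1, h2, hF, H2.dx_zero_of_mem_V hℓ h3, hD.S_eq,
      ContinuousLinearMap.adjoint_comp]
    simp only [ContinuousLinearMap.comp_apply, map_add]
    abel
  have h5 := tendsto_average_adjoint_prim hℓ (g t • L2.one B.ℓ - (L2.prim B.ℓ).adjoint F)
  have h6 : ⟪L2.one B.ℓ, g t • L2.one B.ℓ - (L2.prim B.ℓ).adjoint F⟫ =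
      g t * B.ℓ - ⟪F, L2.prim B.ℓ (L2.one B.ℓ)⟫ := by
    rw [inner_sub_right, real_inner_smul_right, L2.inner_one hℓ.le (L2.one B.ℓ),
      intervalIntegral_congr_of_ae_Ioo L2.coeFn_one ⟨hℓ.le, le_rfl⟩,
      ContinuousLinearMap.adjoint_inner_right, real_inner_comm]
    simp
  rw [h6] at h5
  refine Tendsto.limUnder_eq (h5.congr' ?_)
  filter_upwards [Ioc_mem_nhdsGT hℓ] with h hh
  congr 1
  refine intervalIntegral_congr_of_ae_Ioo ?_ ⟨hh.1.le, hh.2⟩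
  rw [← h4]
  filter_upwards [Lp.coeFn_add (D.R ((s.u t).dx 2)) (D.κ ((s.ut t).dx 2)),
    hD.R_eq ((s.u t).dx 2), hD.κ_eq ((s.ut t).dx 2)] with x e1 e2 e3
  rw [e1, Pi.add_apply, e2, e3]

end IsWeakSolution

/-- The motion with given curvature rate and acceleration. -/
def motionOf (B : Beam) (U P : ℝ → L2 B.ℓ) : Motion B.ℓ where
  u := fun t => H2.ofDx2 B.ℓ (∫ s in (0 : ℝ)..t, U s)
  ut := fun t => H2.ofDx2 B.ℓ (U t)
  utt := P

theorem IsSystem.isWeakSolution (hℓ : 0 < B.ℓ) (hD : B.IsSystem D) {U P : ℝ → L2 B.ℓ}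
    (hs : D.IsSol T g U P) : B.IsWeakSolution T g (B.motionOf U P) where
  memLp_u := (H2.ofDx2 B.ℓ).comp_memLp' (memLp_primitive hs.memLp_U.integrable_of_Ioo)
  memLp_ut := (H2.ofDx2 B.ℓ).comp_memLp' hs.memLp_U
  memLp_utt := hs.memLp_P
  u_mem := ae_of_all _ fun _ => H2.ofDx2_mem_V hℓ _
  ut_mem := ae_of_all _ fun _ => H2.ofDx2_mem_V hℓ _
  u_eq := by
    filter_upwards [ae_restrict_mem measurableSet_Ioo] with t ht
    exact (ContinuousLinearMap.intervalIntegral_comp_of_Ioo (L2.prim B.ℓ ∘L L2.prim B.ℓ)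
      hs.memLp_U.integrable_of_Ioo (Ioo_subset_Icc_self ht)).symm
  ut_eq := by
    filter_upwards [hs.S_eq] with t ht
    rw [hD.S_eq] at ht
    exact ht
  weak_form := by
    filter_upwards [hs.eqn] with t h1 v hv
    rw [H2.val_end_eq_of_mem hℓ hv.1, hv.2, mul_zero, zero_add,
      pair_eq_inner hℓ.le hD.ρ_eq, pair_eq_inner hℓ.le hD.μ_eq,
      pair_eq_inner hℓ.le hD.R_eq, pair_eq_inner hℓ.le hD.κ_eq, H2.dx_zero_of_mem_V hℓ hv,
      ← hD.b_eq, ← real_inner_smul_left, ← h1, inner_add_left, inner_add_left, inner_add_left,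
      ContinuousLinearMap.adjoint_inner_left, ContinuousLinearMap.adjoint_inner_left, hD.S_eq]
    rfl

end Beam

/-! ### Sobolev functions of time -/

theorem AbsolutelyContinuousOnInterval.congr {f g : ℝ → ℝ} {a b : ℝ}
    (hf : AbsolutelyContinuousOnInterval f a b) (h : EqOn g f (uIcc a b)) :
    AbsolutelyContinuousOnInterval g a b := by
  rw [absolutelyContinuousOnInterval_iff] at hf ⊢
  intro ε hε
  obtain ⟨δ, hδ, H⟩ := hf ε hε
  refine ⟨δ, hδ, fun E hE hE' => ?_⟩
  refine (Finset.sum_congr rfl fun i hi => ?_).trans_lt (H E hE hE')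
  rw [h (hE.1 i hi).1, h (hE.1 i hi).2]

namespace MemSobolev

variable {m j : ℕ} {T : ℝ} {f g : ℝ → ℝ}

theorem derivOn_succ (j : ℕ) (T : ℝ) (f : ℝ → ℝ) :
    derivOn (j + 1) T f = derivWithin (derivOn j T f) (Icc 0 T) := by
  ext t
  rw [derivOn, iteratedDerivWithin_succ]
  rfl

theorem continuousOn (hT : 0 ≤ T) (hf : MemSobolev m T f) (hj : j < m) :
    ContinuousOn (derivOn j T f) (Icc 0 T) := by
  have h := (hf.1 j hj).continuousOn
  rwa [uIcc_of_le hT] at h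

theorem memLp_derivOn (hT : 0 ≤ T) (hf : MemSobolev m T f) (hj : j ≤ m) :
    MemLp (derivOn j T f) 2 (volume.restrict (Ioo 0 T)) := by
  rcases hj.lt_or_eq with h | rfl
  · exact memLp_of_continuousOn_Icc (hf.continuousOn hT h)
  · exact hf.2

/-- The fundamental theorem of calculus. -/
theorem derivOn_eq_add_integral (hf : MemSobolev m T f) (hj : j < m) {t : ℝ} (ht : t ∈ Icc 0 T) :
    derivOn j T f t = derivOn j T f 0 + ∫ s in (0 : ℝ)..t, derivOn (j + 1) T f s := by
  have hac : AbsolutelyContinuousOnInterval (derivOn j T f) 0 t :=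
    (hf.1 j hj).mono (by
      rw [uIcc_of_le ht.1, uIcc_of_le (ht.1.trans ht.2)]
      exact Icc_subset_Icc_right ht.2)
  have h1 : ∫ s in (0 : ℝ)..t, derivOn (j + 1) T f s =
      ∫ s in (0 : ℝ)..t, deriv (derivOn j T f) s := by
    refine intervalIntegral_congr_of_ae_Ioo ?_ ht
    filter_upwards [ae_restrict_mem measurableSet_Ioo] with s hs
    rw [derivOn_succ]
    exact derivWithin_of_mem_nhds (Icc_mem_nhds hs.1 hs.2)
  rw [h1, hac.integral_deriv_eq_sub]
  ring

theorem differentiableWithinAt (hT : 0 ≤ T) (hf : MemSobolev m T f) (hj : j + 1 < m) {t : ℝ}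
    (ht : t ∈ Icc 0 T) : DifferentiableWithinAt ℝ (derivOn j T f) (Icc 0 T) t := by
  have hc := hf.continuousOn hT hj
  have : Fact (t ∈ Icc 0 T) := ⟨ht⟩
  have h1 : HasDerivWithinAt (fun u => ∫ s in (0 : ℝ)..u, derivOn (j + 1) T f s)
      (derivOn (j + 1) T f t) (Icc 0 T) t := by
    refine intervalIntegral.integral_hasDerivWithinAt_right
      ((hf.memLp_derivOn hT hj.le).integrable_of_Ioo.intervalIntegrable_of_Ioo ⟨le_rfl, hT⟩ ht)
      ⟨Icc 0 T, self_mem_nhdsWithin, hc.aestronglyMeasurable measurableSet_Icc⟩ (hc t ht)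
  exact ((h1.const_add (derivOn j T f 0)).congr
    (fun u hu => hf.derivOn_eq_add_integral (by omega) hu)
    (hf.derivOn_eq_add_integral (by omega) ht)).differentiableWithinAt

theorem ae_differentiableWithinAt (hf : MemSobolev m T f) (hj : j < m) :
    ∀ᵐ t ∂(volume.restrict (Ioo 0 T)),
      DifferentiableWithinAt ℝ (derivOn j T f) (Icc 0 T) t := by
  filter_upwards [ae_restrict_of_ae (hf.1 j hj).ae_differentiableAt,
    ae_restrict_mem measurableSet_Ioo] with t h ht
  have ht' : t ∈ uIcc 0 T := by
    rw [uIcc_of_le (ht.1.trans ht.2).le]; exact Ioo_subset_Icc_self ht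
  exact (h ht').differentiableWithinAt

theorem derivOn_succ_comb {a b t : ℝ} (hT : 0 < T)
    (h : ∀ s ∈ Icc 0 T, derivOn j T (fun t => a * f t + b * g t) s =
      a * derivOn j T f s + b * derivOn j T g s) (ht : t ∈ Icc 0 T)
    (hf : DifferentiableWithinAt ℝ (derivOn j T f) (Icc 0 T) t)
    (hg : DifferentiableWithinAt ℝ (derivOn j T g) (Icc 0 T) t) :
    derivOn (j + 1) T (fun t => a * f t + b * g t) t =
      a * derivOn (j + 1) T f t + b * derivOn (j + 1) T g t := by
  rw [derivOn_succ, derivOn_succ, derivOn_succ, derivWithin_congr h (h t ht)]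
  exact ((hf.hasDerivWithinAt.const_mul a).add (hg.hasDerivWithinAt.const_mul b)).derivWithin
    (uniqueDiffOn_Icc hT t ht)

theorem derivOn_comb (hT : 0 < T) (hf : MemSobolev m T f) (hg : MemSobolev m T g) (a b : ℝ) :
    ∀ j < m, ∀ t ∈ Icc 0 T, derivOn j T (fun t => a * f t + b * g t) t =
      a * derivOn j T f t + b * derivOn j T g t := by
  intro j
  induction j with
  | zero => intro _ t _; simp [derivOn]
  | succ j ih =>
    intro hj t ht
    exact derivOn_succ_comb hT (ih (by omega)) ht (hf.differentiableWithinAt hT.le hj ht)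
      (hg.differentiableWithinAt hT.le hj ht)

theorem ae_derivOn_comb (hT : 0 < T) (hf : MemSobolev m T f) (hg : MemSobolev m T g) (a b : ℝ)
    (hj : j ≤ m) : ∀ᵐ t ∂(volume.restrict (Ioo 0 T)),
      derivOn j T (fun t => a * f t + b * g t) t = a * derivOn j T f t + b * derivOn j T g t := by
  rcases hj.lt_or_eq with h | rfl
  · filter_upwards [ae_restrict_mem measurableSet_Ioo] with t ht
    exact derivOn_comb hT hf hg a b j h t (Ioo_subset_Icc_self ht)
  · cases j with
    | zero => exact ae_of_all _ fun t => by simp [derivOn]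
    | succ j =>
      filter_upwards [hf.ae_differentiableWithinAt j.lt_succ_self,
        hg.ae_differentiableWithinAt j.lt_succ_self, ae_restrict_mem measurableSet_Ioo]
        with t h1 h2 ht
      exact derivOn_succ_comb hT (derivOn_comb hT hf hg a b j j.lt_succ_self)
        (Ioo_subset_Icc_self ht) h1 h2

theorem comb (hT : 0 < T) (hf : MemSobolev m T f) (hg : MemSobolev m T g) (a b : ℝ) :
    MemSobolev m T (fun t => a * f t + b * g t) := by
  constructor
  · intro j hj
    refine (((hf.1 j hj).const_mul a).add ((hg.1 j hj).const_mul b)).congr ?_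
    rw [uIcc_of_le hT.le]
    exact fun t ht => derivOn_comb hT hf hg a b j hj t ht
  · refine (((hf.2).const_mul a).add ((hg.2).const_mul b)).ae_eq ?_
    filter_upwards [ae_derivOn_comb hT hf hg a b le_rfl] with t ht
    exact ht.symm

end MemSobolev

theorem integral_sq_add_mul {α : Type*} [MeasurableSpace α] {m : Measure α} {p q : α → ℝ}
    (hp : MemLp p 2 m) (hq : MemLp q 2 m) (ε : ℝ) :
    ∫ t, (p t + ε * q t) ^ 2 ∂m =
      ∫ t, p t ^ 2 ∂m + ε * (2 * ∫ t, p t * q t ∂m) + ε ^ 2 * ∫ t, q t ^ 2 ∂m := by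
  have i1 : Integrable (fun t => p t ^ 2) m := hp.integrable_sq
  have i2 : Integrable (fun t => ε * 2 * (p t * q t)) m := (hp.integrable_mul hq).const_mul _
  have i3 : Integrable (fun t => ε ^ 2 * q t ^ 2) m := hq.integrable_sq.const_mul _
  calc ∫ t, (p t + ε * q t) ^ 2 ∂m
      = ∫ t, (p t ^ 2 + ε * 2 * (p t * q t) + ε ^ 2 * q t ^ 2) ∂m := by
        congr 1; ext t; ring
    _ = _ := by
        rw [integral_add (f := fun t => p t ^ 2 + ε * 2 * (p t * q t)) (i1.add i2) i3,
          integral_add i1 i2, integral_const_mul, integral_const_mul]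
        ring

theorem convex_comb_mem_admissibleSet {m : ℕ} {T C : ℝ} (hT : 0 < T) (hC : 0 ≤ C)
    {f g : ℝ → ℝ} (hf : f ∈ admissibleSet m T C) (hg : g ∈ admissibleSet m T C) {ε : ℝ}
    (hε : ε ∈ Icc (0 : ℝ) 1) : (fun t => (1 - ε) * f t + ε * g t) ∈ admissibleSet m T C := by
  obtain ⟨hf1, hf2, hf3⟩ := hf
  obtain ⟨hg1, hg2, hg3⟩ := hg
  refine ⟨hf1.comb hT hg1 _ _, fun j hj => ?_, ?_⟩
  · rw [hf1.derivOn_comb hT hg1 _ _ j hj 0 ⟨le_rfl, hT.le⟩, hf2 j hj, hg2 j hj]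
    simp
  · rw [sobolevNorm, Real.sqrt_le_left hC] at hf3 hg3 ⊢
    have hterm : ∀ j ∈ Finset.range (m + 1),
        ∫ t in (0 : ℝ)..T, (derivOn j T (fun t => (1 - ε) * f t + ε * g t) t) ^ 2 ≤
          (1 - ε) * (∫ t in (0 : ℝ)..T, (derivOn j T f t) ^ 2)
            + ε * ∫ t in (0 : ℝ)..T, (derivOn j T g t) ^ 2 := by
      intro j hj
      have hj' : j ≤ m := Nat.lt_succ_iff.1 (Finset.mem_range.1 hj)
      have i1 := ((hf1.memLp_derivOn hT.le hj').integrable_sq).const_mul (1 - ε)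
      have i2 := ((hg1.memLp_derivOn hT.le hj').integrable_sq).const_mul ε
      rw [intervalIntegral_eq_setIntegral_Ioo hT.le, intervalIntegral_eq_setIntegral_Ioo hT.le,
        intervalIntegral_eq_setIntegral_Ioo hT.le, ← integral_const_mul, ← integral_const_mul,
        ← integral_add i1 i2]
      refine integral_mono_ae
        (((hf1.comb hT hg1 (1 - ε) ε).memLp_derivOn hT.le hj').integrable_sq) (i1.add i2) ?_
      filter_upwards [hf1.ae_derivOn_comb hT hg1 (1 - ε) ε hj'] with t ht
      simp only [ht]
      nlinarith [mul_nonneg (mul_nonneg hε.1 (sub_nonneg.2 hε.2))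
        (sq_nonneg (derivOn j T f t - derivOn j T g t))]
    refine (Finset.sum_le_sum hterm).trans ?_
    rw [Finset.sum_add_distrib, ← Finset.mul_sum, ← Finset.mul_sum]
    nlinarith [mul_le_mul_of_nonneg_left hf3 (sub_nonneg.2 hε.2),
      mul_le_mul_of_nonneg_left hg3 hε.1]

/-! ### First variation of the Tikhonov functional -/

theorem nonneg_of_forall_add_sq {b K : ℝ} (h : ∀ ε ∈ Ioc (0 : ℝ) 1, 0 ≤ ε * b + ε ^ 2 * K) :
    0 ≤ b := by
  by_contra! hb
  have hK : 0 < |K| + 1 := by positivity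
  set ε := min 1 (-b / (2 * (|K| + 1))) with hε
  have h0 : 0 < ε := lt_min one_pos (div_pos (by linarith) (by positivity))
  have h1 : ε * (2 * (|K| + 1)) ≤ -b :=
    (le_div_iff₀ (by positivity)).1 (min_le_right _ _)
  have h2 := h ε ⟨h0, min_le_left _ _⟩
  have h3 : 0 ≤ b + ε * K := by
    refine nonneg_of_mul_nonneg_right (a := ε) ?_ h0
    linarith
  nlinarith [le_abs_self K]

/-- The variational inequality at a minimizer, along a family of solutions whose outputs depend
linearly on the parameter. -/
theorem Beam.IsOptimal.variational_inequality {B : Beam} {m : ℕ} {T C α : ℝ} (hT : 0 < T)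
    (hC : 0 ≤ C) {data : ℝ → ℝ} {out : Motion B.ℓ → ℝ → ℝ} {g₀ g : ℝ → ℝ} {s : Motion B.ℓ}
    (h : B.IsOptimal m T C α data out g₀ s) (hg : g ∈ admissibleSet m T C)
    (hdata : MemLp data 2 (volume.restrict (Ioo 0 T)))
    (hout : MemLp (out s) 2 (volume.restrict (Ioo 0 T))) {w : ℝ → ℝ}
    (hw : MemLp w 2 (volume.restrict (Ioo 0 T)))
    (hfam : ∀ ε : ℝ, ∃ s', B.IsWeakSolution T (fun t => (1 - ε) * g₀ t + ε * g t) s' ∧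
      out s' =ᵐ[volume.restrict (Ioo 0 T)] fun t => out s t + ε * w t) :
    0 ≤ (∫ t in (0 : ℝ)..T, (out s t - data t) * w t)
      + α * ∫ t in (0 : ℝ)..T, derivOn m T g₀ t * (derivOn m T g t - derivOn m T g₀ t) := by
  obtain ⟨hg₀, -, hmin⟩ := h
  have m0 := hg₀.1.memLp_derivOn hT.le le_rfl
  have m1 := (hg.1.memLp_derivOn hT.le le_rfl).sub m0
  have md := hout.sub hdata
  simp only [intervalIntegral_eq_setIntegral_Ioo hT.le]
  refine nonneg_of_forall_add_sq (K := 1 / 2 * (∫ t in Ioo 0 T, w t ^ 2)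
    + α / 2 * ∫ t in Ioo 0 T, (derivOn m T g t - derivOn m T g₀ t) ^ 2) fun ε hε => ?_
  obtain ⟨s', hs', hos⟩ := hfam ε
  have hJ := hmin _ (convex_comb_mem_admissibleSet hT hC hg₀ hg ⟨hε.1.le, hε.2⟩) s' hs'
  simp only [Beam.tikhonov, intervalIntegral_eq_setIntegral_Ioo hT.le] at hJ
  have e1 : ∫ t in Ioo 0 T, (out s' t - data t) ^ 2 =
      ∫ t in Ioo 0 T, ((out s t - data t) + ε * w t) ^ 2 := by
    refine integral_congr_ae ?_
    filter_upwards [hos] with t ht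
    rw [ht]
    ring
  have e2 : ∫ t in Ioo 0 T, (derivOn m T (fun t => (1 - ε) * g₀ t + ε * g t) t) ^ 2 =
      ∫ t in Ioo 0 T, (derivOn m T g₀ t + ε * (derivOn m T g t - derivOn m T g₀ t)) ^ 2 := by
    refine integral_congr_ae ?_
    filter_upwards [hg₀.1.ae_derivOn_comb hT hg.1 (1 - ε) ε le_rfl] with t ht
    rw [ht]
    ring
  have e3 := integral_sq_add_mul md hw ε
  have e4 := integral_sq_add_mul m0 m1 ε
  simp only [Pi.sub_apply] at e3 e4
  rw [e1, e2, e3, e4] at hJ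
  linarith

namespace DampedSystem.IsSol

variable {V H : Type*} [NormedAddCommGroup V] [InnerProductSpace ℝ V] [CompleteSpace V]
  [NormedAddCommGroup H] [InnerProductSpace ℝ H] [CompleteSpace H] {D : DampedSystem V H}
  {T : ℝ} {h k : ℝ → ℝ} {U Y : ℝ → V} {P Q : ℝ → H}

theorem congr_load (hs : D.IsSol T h U P) (hk : ∀ t ∈ Ioo 0 T, h t = k t) : D.IsSol T k U P where
  memLp_U := hs.memLp_U
  memLp_P := hs.memLp_P
  S_eq := hs.S_eq
  eqn := by
    filter_upwards [hs.eqn, ae_restrict_mem measurableSet_Ioo] with t h1 ht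
    rw [h1, hk t ht]

theorem congr_velocity (hs : D.IsSol T h U P) (hY : U =ᵐ[volume.restrict (Ioo 0 T)] Y) :
    D.IsSol T h Y P where
  memLp_U := hs.memLp_U.ae_eq hY
  memLp_P := hs.memLp_P
  S_eq := by
    filter_upwards [hs.S_eq, hY] with t h1 h2
    rw [← h2, h1]
  eqn := by
    filter_upwards [hs.eqn, hY, ae_restrict_mem measurableSet_Ioo] with t h1 h2 ht
    rw [← h2, ← intervalIntegral_congr_of_ae_Ioo hY (Ioo_subset_Icc_self ht), h1]

theorem integral_add_smul {E : Type*} [NormedAddCommGroup E] [NormedSpace ℝ E]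
    {f g : ℝ → E} (hf : MemLp f 2 (volume.restrict (Ioo 0 T)))
    (hg : MemLp g 2 (volume.restrict (Ioo 0 T))) (ε : ℝ) {t : ℝ} (ht : t ∈ Icc 0 T) :
    ∫ s in (0 : ℝ)..t, (f s + ε • g s) =
      (∫ s in (0 : ℝ)..t, f s) + ε • ∫ s in (0 : ℝ)..t, g s := by
  have h0 : (0 : ℝ) ∈ Icc 0 T := ⟨le_rfl, ht.1.trans ht.2⟩
  refine (intervalIntegral.integral_add (hf.integrable_of_Ioo.intervalIntegrable_of_Ioo h0 ht)
    ((hg.integrable_of_Ioo.intervalIntegrable_of_Ioo h0 ht).smul ε)).trans ?_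
  exact congrArg _ (intervalIntegral.integral_smul ε g)

theorem add_smul (hs : D.IsSol T h U P) (hk : D.IsSol T k Y Q) (ε : ℝ) :
    D.IsSol T (fun t => h t + ε * k t) (fun t => U t + ε • Y t) (fun t => P t + ε • Q t) where
  memLp_U := hs.memLp_U.add (hk.memLp_U.const_smul ε)
  memLp_P := hs.memLp_P.add (hk.memLp_P.const_smul ε)
  S_eq := by
    filter_upwards [hs.S_eq, hk.S_eq, ae_restrict_mem measurableSet_Ioo] with t h1 h2 ht
    rw [map_add, map_smul, h1, h2,
      integral_add_smul hs.memLp_P hk.memLp_P ε (Ioo_subset_Icc_self ht)]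
  eqn := by
    filter_upwards [hs.eqn, hk.eqn, ae_restrict_mem measurableSet_Ioo] with t h1 h2 ht
    rw [integral_add_smul hs.memLp_U hk.memLp_U ε (Ioo_subset_Icc_self ht), _root_.add_smul,
      mul_smul, ← h1, ← h2]
    simp only [map_add, map_smul, smul_add]
    abel

end DampedSystem.IsSol

/-- Differences of admissible inputs are iterated primitives of their derivatives. -/
theorem integral_derivOn_sub_of_mem_admissibleSet {m j : ℕ} {T C : ℝ} {f g : ℝ → ℝ}
    (hf : f ∈ admissibleSet m T C) (hg : g ∈ admissibleSet m T C) (hj : j < m) {t : ℝ}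
    (ht : t ∈ Icc 0 T) :
    ∫ s in (0 : ℝ)..t, (derivOn (j + 1) T g s - derivOn (j + 1) T f s) =
      derivOn j T g t - derivOn j T f t := by
  have hT : 0 ≤ T := ht.1.trans ht.2
  have h0 : (0 : ℝ) ∈ Icc 0 T := ⟨le_rfl, hT⟩
  rw [intervalIntegral.integral_sub
    ((hg.1.memLp_derivOn hT hj).integrable_of_Ioo.intervalIntegrable_of_Ioo h0 ht)
    ((hf.1.memLp_derivOn hT hj).integrable_of_Ioo.intervalIntegrable_of_Ioo h0 ht),
    hg.1.derivOn_eq_add_integral hj ht, hf.1.derivOn_eq_add_integral hj ht, hg.2.1 j hj,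
    hf.2.1 j hj, zero_add, zero_add]

/-- An iterated antiderivative of a continuous function is twice continuously differentiable. -/
theorem contDiff_two_of_hasDerivAt {E : Type*} [NormedAddCommGroup E] [NormedSpace ℝ E]
    {f f' f'' : ℝ → E} (h1 : ∀ t, HasDerivAt f (f' t) t) (h2 : ∀ t, HasDerivAt f' (f'' t) t)
    (h3 : Continuous f'') : ContDiff ℝ 2 f := by
  have e1 : deriv f = f' := funext fun t => (h1 t).deriv
  have e2 : deriv f' = f'' := funext fun t => (h2 t).deriv
  have h4 : ContDiff ℝ 1 f' := by
    rw [contDiff_one_iff_deriv, e2]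
    exact ⟨fun t => (h2 t).differentiableAt, h3⟩
  rw [show (2 : WithTop ℕ∞) = 1 + 1 by norm_num, contDiff_succ_iff_deriv, e1]
  exact ⟨fun t => (h1 t).differentiableAt, by simp, h4⟩

namespace Beam

variable {B : Beam} {D : DampedSystem (L2 B.ℓ) (L2 B.ℓ)} {T C α : ℝ}

theorem memLp_tip (hℓ : 0 < B.ℓ) {g : ℝ → ℝ} {s : Motion B.ℓ} (hs : B.IsWeakSolution T g s) :
    MemLp (B.tip s) 2 (volume.restrict (Ioo 0 T)) := by
  refine ((memLp_primitive hs.memLp_curvature_rate.integrable_of_Ioo).const_inner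
    (𝕜 := ℝ) (H2.tipVector B.ℓ)).ae_eq ?_
  filter_upwards [hs.tip_eq hℓ] with t ht
  exact ht.symm

/-- The necessary condition for the deflection at the tip. -/
theorem tip_variational_inequality (hB : B.Admissible) (hT : 0 < T) (hC : 0 < C)
    {ν : ℝ → ℝ} (hν : MemLp ν 2 (volume.restrict (Ioo 0 T))) {gbar : ℝ → ℝ} {ubar : Motion B.ℓ}
    (hopt : B.IsOptimal 1 T C α ν B.outputΦ gbar ubar) {φ : Motion B.ℓ}
    (hφ : B.IsNeumannAdjoint T (fun t => B.tip ubar t - ν t) φ) {g : ℝ → ℝ}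
    (hg : g ∈ admissibleSet 1 T C) :
    0 ≤ (∫ t in (0 : ℝ)..T, (g t - gbar t) * (φ.u t).val B.ℓ)
      + α * ∫ t in (0 : ℝ)..T, derivOn 1 T gbar t * (derivOn 1 T g t - derivOn 1 T gbar t) := by
  have hℓ := hB.length_pos
  obtain ⟨D, hD⟩ := hB.exists_isSystem
  have hgb := hopt.1
  have hub := hopt.2.1
  have sub := hub.isSol hℓ hD
  have mk : MemLp (fun t => derivOn 1 T g t - derivOn 1 T gbar t) 2 (volume.restrict (Ioo 0 T)) :=
    hg.1.2.sub hgb.1.2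
  obtain ⟨U, P, hsol⟩ := D.exists_isSol hD.coercive hT.le mk
  have hload : ∀ t ∈ Ioo 0 T, ∫ s in (0 : ℝ)..t, (derivOn 1 T g s - derivOn 1 T gbar s) =
      g t - gbar t := fun t ht =>
    integral_derivOn_sub_of_mem_admissibleSet hgb hg one_pos (Ioo_subset_Icc_self ht)
  replace hsol := hsol.congr_load hload
  have mw : MemLp (fun t => ⟪H2.tipVector B.ℓ, ∫ s in (0 : ℝ)..t, U s⟫) 2
      (volume.restrict (Ioo 0 T)) :=
    (memLp_primitive hsol.memLp_U.integrable_of_Ioo).const_inner (𝕜 := ℝ) _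
  have hvar := hopt.variational_inequality hT hC.le hg hν (memLp_tip hℓ hub) mw <| by
    intro ε
    have hsε := (sub.add_smul hsol ε).congr_load
      (k := fun t => (1 - ε) * gbar t + ε * g t) fun t _ => by ring
    refine ⟨B.motionOf _ _, hD.isWeakSolution hℓ hsε, ?_⟩
    filter_upwards [(hD.isWeakSolution hℓ hsε).tip_eq hℓ, hub.tip_eq hℓ,
      ae_restrict_mem measurableSet_Ioo] with t h1 h2 ht
    change B.tip _ t = B.tip ubar t + _
    rw [h1, h2]
    simp only [motionOf, H2.dx_two_ofDx2]
    rw [DampedSystem.IsSol.integral_add_smul sub.memLp_U hsol.memLp_U ε (Ioo_subset_Icc_self ht),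
      inner_add_right, real_inner_smul_right]
  have hrec := hsol.reciprocity hD.symmetric hT.le (hφ.isSol hℓ hD)
  suffices h : ∫ t in (0 : ℝ)..T, (g t - gbar t) * (φ.u t).val B.ℓ =
      ∫ t in (0 : ℝ)..T, (B.outputΦ ubar t - ν t) *
        ⟪H2.tipVector B.ℓ, ∫ s in (0 : ℝ)..t, U s⟫ by
    rw [h]; exact hvar
  rw [intervalIntegral_eq_setIntegral_Ioo hT.le, intervalIntegral_eq_setIntegral_Ioo hT.le]
  rw [hD.b_eq] at hrec
  simp only [sub_sub_cancel] at hrec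
  refine Eq.trans (integral_congr_ae ?_) hrec
  filter_upwards [ae_reflect (hφ.tip_eq hℓ)] with t ht
  rw [← ht]
  simp only [tip, Motion.reverse, sub_sub_cancel]

theorem memLp_momentAtZero (hℓ : 0 < B.ℓ) (hD : B.IsSystem D) {g : ℝ → ℝ} {s : Motion B.ℓ}
    (hg : MemLp g 2 (volume.restrict (Ioo 0 T))) (hs : B.IsWeakSolution T g s) :
    MemLp (B.momentAtZero s) 2 (volume.restrict (Ioo 0 T)) := by
  refine ((hg.mul_const B.ℓ).sub
    (((D.ρ.comp_memLp' hs.memLp_utt).add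
      (D.μ.comp_memLp' ((H2.dxL 0).comp_memLp' hs.memLp_ut))).inner_const (𝕜 := ℝ)
        (L2.prim B.ℓ (L2.one B.ℓ)))).ae_eq ?_
  filter_upwards [hs.momentAtZero_eq hℓ hD] with t ht
  exact ht.symm

/-- Testing the adjoint problem with Dirichlet input by a smooth solution of the direct
problem. -/
theorem IsDirichletAdjoint.integral_eq (hℓ : 0 < B.ℓ) (hT : 0 < T) (hD : B.IsSystem D)
    {θ : ℝ → ℝ} {φ : ℝ → H2 B.ℓ} (hφ : B.IsDirichletAdjoint T θ φ)
    (hθ : MemLp θ 2 (volume.restrict (Ioo 0 T))) {h : ℝ → ℝ}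
    (hh : MemLp h 2 (volume.restrict (Ioo 0 T)))
    {U : ℝ → L2 B.ℓ} (hUc : Continuous U) {Q : ℝ → L2 B.ℓ}
    (hSU : ∀ t ∈ Ioo 0 T, D.S (U t) = Q t)
    (hs : D.IsSol T h (fun t => ∫ s in (0 : ℝ)..t, U s) Q) :
    ∫ t in (0 : ℝ)..T, h t * (φ t).val B.ℓ =
      ∫ t in (0 : ℝ)..T, θ t * (h t * B.ℓ
        - ⟪D.ρ (Q t) + D.μ (D.S (∫ s in (0 : ℝ)..t, U s)), L2.prim B.ℓ (L2.one B.ℓ)⟫) := by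
  set X := L2.prim B.ℓ (L2.one B.ℓ) with hX
  set U' : ℝ → L2 B.ℓ := fun t => ∫ s in (0 : ℝ)..t, U s with hU'
  have dU' : ∀ t, HasDerivAt U' (U t) t := fun t => (hUc.integral_hasStrictDerivAt 0 t).hasDerivAt
  have hU'c : Continuous U' := continuous_iff_continuousAt.2 fun t => (dU' t).continuousAt
  have dW : ∀ t, HasDerivAt (fun t => ∫ s in (0 : ℝ)..t, U' s) (U' t) t :=
    fun t => (hU'c.integral_hasStrictDerivAt 0 t).hasDerivAt
  let v : ℝ → H2 B.ℓ := fun t => H2.ofDx2 B.ℓ (∫ s in (0 : ℝ)..t, U' s)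
  have dv : ∀ t, HasDerivAt v (H2.ofDx2 B.ℓ (U' t)) t := fun t =>
    (H2.ofDx2 B.ℓ).hasFDerivAt.comp_hasDerivAt t (dW t)
  have ddv : ∀ t, HasDerivAt (fun t => H2.ofDx2 B.ℓ (U' t)) (H2.ofDx2 B.ℓ (U t)) t := fun t =>
    (H2.ofDx2 B.ℓ).hasFDerivAt.comp_hasDerivAt t (dU' t)
  have e1 : deriv v = fun t => H2.ofDx2 B.ℓ (U' t) := funext fun t => (dv t).deriv
  have e2 : deriv (deriv v) = fun t => H2.ofDx2 B.ℓ (U t) := by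
    rw [e1]; exact funext fun t => (ddv t).deriv
  have htest := hφ.weak_form v (contDiff_two_of_hasDerivAt dv ddv (by fun_prop))
    (fun t => H2.ofDx2_mem_V hℓ _) (by simp [v]) (by rw [e1]; simp [hU'])
  rw [e2, e1] at htest
  rw [intervalIntegral_eq_setIntegral_Ioo hT.le] at htest ⊢
  rw [intervalIntegral_eq_setIntegral_Ioo hT.le]
  have mval : MemLp (fun t => (φ t).val B.ℓ) 2 (volume.restrict (Ioo 0 T)) := by
    refine ((hθ.const_mul B.ℓ).add (((H2.dxL 2).comp_memLp' hφ.memLp).const_inner (𝕜 := ℝ)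
      (H2.tipVector B.ℓ))).ae_eq ?_
    filter_upwards [hφ.boundary] with t ht
    rw [H2.val_end_eq_of_mem hℓ ht.1, ht.2]
    rfl
  have mM : MemLp (fun t => h t * B.ℓ - ⟪D.ρ (Q t) + D.μ (D.S (U' t)), X⟫) 2
      (volume.restrict (Ioo 0 T)) :=
    (hh.mul_const B.ℓ).sub (((D.ρ.comp_memLp' hs.memLp_P).add
      ((D.μ ∘L D.S).comp_memLp' hs.memLp_U)).inner_const (𝕜 := ℝ) X)
  have i1 : Integrable (fun t => h t * (φ t).val B.ℓ) (volume.restrict (Ioo 0 T)) :=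
    hh.integrable_mul mval
  have i2 : Integrable (fun t => θ t * (h t * B.ℓ - ⟪D.ρ (Q t) + D.μ (D.S (U' t)), X⟫))
      (volume.restrict (Ioo 0 T)) := hθ.integrable_mul mM
  rw [← sub_eq_zero, ← integral_sub i1 i2]
  refine Eq.trans (integral_congr_ae ?_) htest
  filter_upwards [hφ.boundary, hs.eqn, ae_restrict_mem measurableSet_Ioo] with t hb heq ht
  have hφ0 : (φ t).dx 0 = θ t • X + D.S ((φ t).dx 2) := by
    rw [H2.dx_zero_eq hℓ, H2.dx_one_eq hℓ, hb.1, hb.2, hD.S_eq]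
    simp [hX]
  have hd0 : L2.prim B.ℓ (L2.prim B.ℓ (U t)) = Q t := by
    rw [← hSU t ht, hD.S_eq]; rfl
  have hd1 : L2.prim B.ℓ (L2.prim B.ℓ (U' t)) = D.S (U' t) := by
    rw [hD.S_eq]; rfl
  have hin : ⟪D.ρ (Q t) + D.μ (D.S (U' t)), D.S ((φ t).dx 2)⟫
      + ⟪D.R (∫ s in (0 : ℝ)..t, U' s) + D.κ (U' t), (φ t).dx 2⟫ =
        h t * ⟪H2.tipVector B.ℓ, (φ t).dx 2⟫ := by
    rw [← hD.b_eq, ← real_inner_smul_left, ← heq, ← ContinuousLinearMap.adjoint_inner_left,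
      ← inner_add_left, map_add]
    congr 1
    abel
  simp only [v]
  rw [H2.val_end_eq_of_mem hℓ hb.1, hb.2, pair_eq_inner hℓ.le hD.ρ_eq,
    pair_eq_inner hℓ.le hD.μ_eq, pair_eq_inner hℓ.le hD.R_eq, pair_eq_inner hℓ.le hD.κ_eq]
  simp only [H2.dx_zero_ofDx2, H2.dx_two_ofDx2]
  rw [hd0, hd1, hD.symmetric.ρ_symm, hD.symmetric.μ_symm, hD.symmetric.R_symm,
    hD.symmetric.κ_symm, hφ0]
  simp only [inner_add_left, inner_add_right, real_inner_smul_right] at hin ⊢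
  linarith

/-- The necessary condition for the moment at the clamped end. -/
theorem moment_variational_inequality (hB : B.Admissible) (hT : 0 < T) (hC : 0 < C)
    {ω : ℝ → ℝ} (hω : MemLp ω 2 (volume.restrict (Ioo 0 T))) {gbar : ℝ → ℝ} {ubar : Motion B.ℓ}
    (hopt : B.IsOptimal 3 T C α ω B.outputΨ gbar ubar) {φ : ℝ → H2 B.ℓ}
    (hφ : B.IsDirichletAdjoint T (fun t => B.momentAtZero ubar t + ω t) φ) {g : ℝ → ℝ}
    (hg : g ∈ admissibleSet 3 T C) :
    0 ≤ (∫ t in (0 : ℝ)..T, (g t - gbar t) * (φ t).val B.ℓ)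
      + α * ∫ t in (0 : ℝ)..T, derivOn 3 T gbar t * (derivOn 3 T g t - derivOn 3 T gbar t) := by
  have hℓ := hB.length_pos
  obtain ⟨D, hD⟩ := hB.exists_isSystem
  have hgb := hopt.1
  have hub := hopt.2.1
  have sub := hub.isSol hℓ hD
  let d : ℕ → ℝ → ℝ := fun j t => derivOn j T g t - derivOn j T gbar t
  have md : ∀ j ≤ 3, MemLp (d j) 2 (volume.restrict (Ioo 0 T)) := fun j hj =>
    (hg.1.memLp_derivOn hT.le hj).sub (hgb.1.memLp_derivOn hT.le hj)
  have hd : ∀ j < 3, ∀ t ∈ Ioo 0 T, ∫ s in (0 : ℝ)..t, d (j + 1) s = d j t := fun j hj t ht =>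
    integral_derivOn_sub_of_mem_admissibleSet hgb hg hj (Ioo_subset_Icc_self ht)
  obtain ⟨U₀, P₀, hsol₀⟩ := D.exists_isSol hD.coercive hT.le (md 3 le_rfl)
  have hind : U₀ =ᵐ[volume.restrict (Ioo 0 T)] (Ioo 0 T).indicator U₀ := by
    filter_upwards [ae_restrict_mem measurableSet_Ioo] with t ht
    rw [indicator_of_mem ht]
  replace hsol₀ := (hsol₀.congr_load (hd 2 (by norm_num))).congr_velocity hind
  have hint : Integrable ((Ioo 0 T).indicator U₀) volume :=
    (integrable_indicator_iff measurableSet_Ioo).2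
      (hsol₀.memLp_U.integrable_of_Ioo.congr hind.symm)
  set U₁ : ℝ → L2 B.ℓ := fun t => ∫ s in (0 : ℝ)..t, (Ioo 0 T).indicator U₀ s with hU₁
  have hU₁c : Continuous U₁ := intervalIntegral.continuous_primitive
    (fun a b => hint.intervalIntegrable) 0
  have hsol₁ := hsol₀.primitive.congr_load (hd 1 (by norm_num))
  have hsol := hsol₁.primitive.congr_load (hd 0 (by norm_num))
  set U : ℝ → L2 B.ℓ := fun t => ∫ s in (0 : ℝ)..t, U₁ s with hU
  set P : ℝ → L2 B.ℓ := fun t => ∫ s in (0 : ℝ)..t, ∫ τ in (0 : ℝ)..s, P₀ τ with hP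
  have hd0 : d 0 = fun t => g t - gbar t := by
    funext t; simp [d, derivOn]
  rw [hd0] at hsol
  have mgb : MemLp gbar 2 (volume.restrict (Ioo 0 T)) := by
    have := hgb.1.memLp_derivOn hT.le (zero_le : 0 ≤ 3)
    rwa [derivOn, iteratedDerivWithin_zero] at this
  have mh : MemLp (fun t => g t - gbar t) 2 (volume.restrict (Ioo 0 T)) := hd0 ▸ md 0 (by norm_num)
  have mM := memLp_momentAtZero hℓ hD mgb hub
  set M : ℝ → ℝ := fun t => (g t - gbar t) * B.ℓ
    - ⟪D.ρ (P t) + D.μ (D.S (U t)), L2.prim B.ℓ (L2.one B.ℓ)⟫ with hM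
  have mMw : MemLp M 2 (volume.restrict (Ioo 0 T)) :=
    (mh.mul_const B.ℓ).sub (((D.ρ.comp_memLp' hsol.memLp_P).add
      ((D.μ ∘L D.S).comp_memLp' hsol.memLp_U)).inner_const (𝕜 := ℝ) _)
  have hvar := hopt.variational_inequality hT hC.le hg hω mM.neg mMw.neg <| by
    intro ε
    have hsε := (sub.add_smul hsol ε).congr_load
      (k := fun t => (1 - ε) * gbar t + ε * g t) fun t _ => by ring
    refine ⟨B.motionOf _ _, hD.isWeakSolution hℓ hsε, ?_⟩
    filter_upwards [(hD.isWeakSolution hℓ hsε).momentAtZero_eq hℓ hD, hub.momentAtZero_eq hℓ hD,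
      hub.ut_mem] with t h1 h2 h3
    change -B.momentAtZero _ t = -B.momentAtZero ubar t + ε * -M t
    rw [h1, h2, H2.dx_zero_of_mem_V hℓ h3, hM]
    simp only [motionOf, H2.dx_zero_ofDx2]
    simp only [hD.S_eq, ContinuousLinearMap.comp_apply, map_add,
      map_smul, inner_add_left, real_inner_smul_left]
    ring
  have hadj := hφ.integral_eq hℓ hT hD (mM.add hω) mh hU₁c
    (fun t ht => hsol₀.S_primitive (Ioo_subset_Icc_self ht)) hsol
  rw [hadj]
  refine hvar.trans_eq ?_
  congr 1
  refine intervalIntegral.integral_congr fun t _ => ?_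
  simp only [outputΨ, Pi.neg_apply, hM]
  ring

end Beam

end

theorem proposition5p1 (B : Beam) (hB : B.Admissible) (T : ℝ) (hT : 0 < T) (C : ℝ) (hC : 0 < C)
    (α : ℝ) (hα : 0 < α) :
    (∀ ν : ℝ → ℝ, MemLp ν 2 (volume.restrict (Ioo 0 T)) →
      ∀ (gbar : ℝ → ℝ) (ubar : Motion B.ℓ), B.IsOptimal 1 T C α ν B.outputΦ gbar ubar →
      ∀ φ : Motion B.ℓ, B.IsNeumannAdjoint T (fun t => B.tip ubar t - ν t) φ →
      ∀ g ∈ admissibleSet 1 T C,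
        0 ≤ (∫ t in (0 : ℝ)..T, (g t - gbar t) * (φ.u t).val B.ℓ)
          + α * ∫ t in (0 : ℝ)..T, derivOn 1 T gbar t * (derivOn 1 T g t - derivOn 1 T gbar t)) ∧
    (∀ ω : ℝ → ℝ, MemLp ω 2 (volume.restrict (Ioo 0 T)) →
      ∀ (gbar : ℝ → ℝ) (ubar : Motion B.ℓ), B.IsOptimal 3 T C α ω B.outputΨ gbar ubar →
      ∀ φ : ℝ → H2 B.ℓ, B.IsDirichletAdjoint T (fun t => B.momentAtZero ubar t + ω t) φ →
      ∀ g ∈ admissibleSet 3 T C,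
        0 ≤ (∫ t in (0 : ℝ)..T, (g t - gbar t) * (φ t).val B.ℓ)
          + α * ∫ t in (0 : ℝ)..T, derivOn 3 T gbar t * (derivOn 3 T g t - derivOn 3 T gbar t)) :=
  ⟨fun _ hν _ _ hopt _ hφ _ hg => Beam.tip_variational_inequality hB hT hC hν hopt hφ hg,
    fun _ hω _ _ hopt _ hφ _ hg => Beam.moment_variational_inequality hB hT hC hω hopt hφ hg⟩
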